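/- Fix rates $\lambda>0$, $\mu>0$, $\Gamma\ge 0$ and probabilities $q,p\in[0,1]$. The 1G1B system is the continuous-time Markov chain $s(t)$ on $\{\emptyset,0,1,2,\dots\}$ with $s(0)=\emptyset$ and transition rates $\lambda$ from $\emptyset$ to $0$, $\lambda q p$ from $i$ to $i+1$, and $\mu+\lambda q(1-p)$ from $i$ to $\emptyset$ (for every $i\ge 0$), all other rates being zero. Let $\rho_{\mathrm{new}}$ be a two-qubit state with fidelity $F_{\mathrm{new}}=\langle\phi^+|\rho_{\mathrm{new}}|\phi^+\rangle$, where $|\phi^+\rangle=(|00\rangle+|11\rangle)/\sqrt2$, and let the jump function be linear, $J(F,\rho_{\mathrm{new}})=aF+b$ with $a,b\in\mathbb R$ such that $aF+b\in[0,1]$ for all $F\in[0,1]$. Put $D_t[F]=e^{-\Gamma t}(F-\tfrac14)+\tfrac14$ and define $$F^{(0)}(t_0)=D_{t_0}[F_{\mathrm{new}}],\qquad F^{(i)}(t_0,\dots,t_i)=D_{t_i}\big[J(F^{(i-1)}(t_0,\dots,t_{i-1}),\rho_{\mathrm{new}})\big]\quad(i\ge1).$$ The fidelity of the system at time $t$ is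 $F(t)=0$ if $s(t)=\emptyset$, and $F(t)=F^{(i)}(T_0(t),\dots,T_i(t))$ if $s(t)=i\ge0$, where $T_j(t)$, for $j<i$, is the time spent in the most recent visit to state $j$, and $T_i(t)$ is the time spent so far in the current visit to state $i$. Let $\alpha=\mu+\lambda q$ and $\gamma=\alpha/(\alpha+\Gamma)$. Then, for every $i\ge 0$, the average fidelity after $i$ purification rounds, $c_i=\mathbb E\big[F^{(i)}(Q_0,\dots,Q_i)\big]$ with $Q_0,\dots,Q_i$ i.i.d. exponential random variables of rate $\alpha$, is $$c_i=\frac14+\Big(F_{\mathrm{new}}-\frac14\Big)a^i\gamma^{i+1}+\Big(\frac a4+b-\frac14\Big)\gamma\,\frac{1-a^i\gamma^i}{1-a\gamma},$$ where the last term is read as $0$ if $a\gamma=1$ (this happens only for $\Gamma=0$, $a=1$, $b=0$, when the factor $\frac a4+b-\frac14$ vanishes). Moreover, the average consumed fidelity $\overline F=\lim_{t\to\infty}\mathbb E[F(t)\mid s(t)\ne\emptyset]$ exists and equals $$\overline F=\frac{\frac14\Gamma+b\lambda qp+F_{\mathrm{new}}\big(\mu+\lambda q(1-p)\big)}{\Gamma+\mu+\lambda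 q(1-pa)}.$$ -/

import Mathlib

open MeasureTheory ProbabilityTheory

noncomputable section

namespace Buffer

/-! ### Two-qubit states and their fidelity -/

open scoped ComplexOrder in
/-- A two-qubit density matrix, in the computational basis. -/
structure TwoQubitState where
  mat : Matrix (Fin 2 × Fin 2) (Fin 2 × Fin 2) ℂ
  posSemidef : mat.PosSemidef
  trace_eq_one : mat.trace = 1

/-- The Bell vector `(|00⟩ + |11⟩) / √2`. -/
def phiPlus : Fin 2 × Fin 2 → ℂ :=
  fun x => if x.1 = x.2 then ((1 / Real.sqrt 2 : ℝ) : ℂ) else 0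

/-- The fidelity `⟨φ⁺| ρ |φ⁺⟩` of a two-qubit state to the Bell state. -/
def TwoQubitState.fidelity (ρ : TwoQubitState) : ℝ :=
  (star phiPlus ⬝ᵥ ρ.mat.mulVec phiPlus).re

/-! ### Decoherence and pumping along a sequence of purification levels -/

/-- Depolarising noise of rate `Γ` acting on a fidelity for a time `t`. -/
def depol (Γ t F : ℝ) : ℝ := Real.exp (-Γ * t) * (F - 1 / 4) + 1 / 4

/-- The fidelity `F^{(i)}(t₀, …, tᵢ)` after spending times `t₀, …, tᵢ` in the purification levels
`0, …, i`, for the jump function `J` and new links in the state `ρ`. -/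
def levelFidelity (Γ : ℝ) (J : ℝ → TwoQubitState → ℝ) (ρ : TwoQubitState) :
    (i : ℕ) → (Fin (i + 1) → ℝ) → ℝ
  | 0, t => depol Γ (t 0) ρ.fidelity
  | i + 1, t =>
      depol Γ (t (Fin.last (i + 1))) (J (levelFidelity Γ J ρ i (fun j => t j.castSucc)) ρ)

/-- The joint law of `Q₀, …, Qᵢ`, i.i.d. exponential with rate `r`. -/
def iidExp (r : ℝ) (i : ℕ) : Measure (Fin (i + 1) → ℝ) :=
  Measure.pi (fun _ => expMeasure r)

/-- `c_i = 𝔼[F^{(i)}(Q₀, …, Qᵢ)]` with `Q₀, …, Qᵢ` i.i.d. exponential with rate `μ + λ q`. -/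
def avgLevelFidelity (lam mu q Γ : ℝ) (J : ℝ → TwoQubitState → ℝ) (ρ : TwoQubitState) (i : ℕ) :
    ℝ :=
  ∫ t, levelFidelity Γ J ρ i t ∂(iidExp (mu + lam * q) i)

/-! ### Continuous-time Markov chains through the jump chain and the holding times -/

section CTMC

variable {S : Type*} [DecidableEq S] {Ω : Type*} [MeasurableSpace Ω]

/-- Total rate of leaving `x`, for transition rates `R` that vanish on the diagonal. -/
def exitRate (R : S → S → ℝ) (x : S) : ℝ := ∑' y, R x y

/-- Probability that a jump out of `x` leads to `y`. -/
def jumpProb (R : S → S → ℝ) (x y : S) : ℝ := R x y / exitRate R x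

/-- `Y` and `H` are the jump chain and the holding times of a continuous-time Markov chain with
transition rates `R`, started in `x₀`: `Y` is a Markov chain with transition matrix `jumpProb R`
and, given `Y`, the `H k` are independent and exponential with rates `exitRate R (Y k)`. -/
structure IsCTMC (R : S → S → ℝ) (x₀ : S) (P : Measure Ω) (Y : ℕ → Ω → S) (H : ℕ → Ω → ℝ) :
    Prop where
  measurableSet_Y : ∀ n x, MeasurableSet {ω | Y n ω = x}
  measurable_H : ∀ n, Measurable (H n)
  law : ∀ (n : ℕ) (y : ℕ → S) (B : ℕ → Set ℝ), (∀ k, MeasurableSet (B k)) →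
    P {ω | ∀ k ≤ n, Y k ω = y k ∧ H k ω ∈ B k} =
      (if y 0 = x₀ then 1 else 0) *
        (∏ k ∈ Finset.range n, ENNReal.ofReal (jumpProb R (y k) (y (k + 1)))) *
        ∏ k ∈ Finset.range (n + 1), expMeasure (exitRate R (y k)) (B k)

/-- Time of the `n`-th jump; `Y n` is entered at this time. -/
def jumpTime (H : ℕ → Ω → ℝ) (n : ℕ) (ω : Ω) : ℝ := ∑ k ∈ Finset.range n, H k ω

/-- Number of jumps up to and including time `t`. -/
def jumpCount (H : ℕ → Ω → ℝ) (t : ℝ) (ω : Ω) : ℕ := sSup {n | jumpTime H n ω ≤ t}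

/-- State at time `t`. -/
def stateAt (Y : ℕ → Ω → S) (H : ℕ → Ω → ℝ) (t : ℝ) (ω : Ω) : S := Y (jumpCount H t ω) ω

end CTMC

/-! ### The 1G1B system

The states are `none` (no link in the good memory) and `some i` (a link that is the result of `i`
successful pumping rounds). -/

/-- Transition rates of the 1G1B system. -/
def bufferRate (lam mu q p : ℝ) : Option ℕ → Option ℕ → ℝ
  | none, none => 0
  | none, some j => if j = 0 then lam else 0
  | some _, none => mu + lam * q * (1 - p)
  | some i, some j => if j = i + 1 then lam * q * p else 0

section System

variable {Ω : Type*} [MeasurableSpace Ω]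

/-- The 1G1B system, which starts without a link. -/
def Is1G1B (lam mu q p : ℝ) (P : Measure Ω) (Y : ℕ → Ω → Option ℕ) (H : ℕ → Ω → ℝ) : Prop :=
  IsCTMC (bufferRate lam mu q p) none P Y H

/-- The vector of times spent in the levels `0, …, i`, when the state at time `t` is `some i`:
for `j < i` the duration of the most recent visit to level `j`, and for `j = i` the time spent
so far in level `i`. -/
def levelTimes (Y : ℕ → Ω → Option ℕ) (H : ℕ → Ω → ℝ) (t : ℝ) (ω : Ω) (i : ℕ) :
    Fin (i + 1) → ℝ :=
  fun j =>
    if (j : ℕ) = i then t - jumpTime H (jumpCount H t ω) ω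
    else H (Nat.findGreatest (fun m => Y m ω = some (j : ℕ)) (jumpCount H t ω)) ω

/-- The fidelity `F(t)` of the system at time `t` (zero if there is no link). -/
def systemFidelity (Γ : ℝ) (J : ℝ → TwoQubitState → ℝ) (ρ : TwoQubitState)
    (Y : ℕ → Ω → Option ℕ) (H : ℕ → Ω → ℝ) (t : ℝ) (ω : Ω) : ℝ :=
  match stateAt Y H t ω with
  | none => 0
  | some i => levelFidelity Γ J ρ i (levelTimes Y H t ω i)

/-- `𝔼[F(t) | s(t) ≠ ∅]`. -/
def condMeanFidelity (Γ : ℝ) (J : ℝ → TwoQubitState → ℝ) (ρ : TwoQubitState) (P : Measure Ω)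
    (Y : ℕ → Ω → Option ℕ) (H : ℕ → Ω → ℝ) (t : ℝ) : ℝ :=
  ∫ ω, systemFidelity Γ J ρ Y H t ω ∂(P[|{ω | stateAt Y H t ω ≠ none}])

/-- `L` is the average consumed fidelity: the limit of `𝔼[F(t) | s(t) ≠ ∅]` as `t → ∞`. -/
def IsAvgConsumedFidelity (Γ : ℝ) (J : ℝ → TwoQubitState → ℝ) (ρ : TwoQubitState)
    (P : Measure Ω) (Y : ℕ → Ω → Option ℕ) (H : ℕ → Ω → ℝ) (L : ℝ) : Prop :=
  (∀ t, Integrable (systemFidelity Γ J ρ Y H t) P) ∧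
    Filter.Tendsto (condMeanFidelity Γ J ρ P Y H) Filter.atTop (nhds L)

end System

end Buffer

end

/-!
Record the chain by its jumps. At the `n`-th jump attach the excess over `1 / 4` of the fidelity of
the link that is present just after it: a fresh link starts again from `F_new - 1 / 4`, and pumping
acts on the excess by `x ↦ a x + (a / 4 + b - 1 / 4)`, while decoherence multiplies it by
`exp (-Γ u)`. Hence the mean excess `M(t)` of the link at time `t`, restricted to `s(t) ≠ ∅`, is the
convolution of `exp (-(μ + λ q + Γ) u)` with a source which is linear in `M` itself and in the
probabilities `O` and `L` of `s(t) = ∅` and of `s(t) ≠ ∅`. The case of constant excess `1` and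
`Γ = 0` is such an equation for `L`.

The source need not converge a priori, because it contains `M`. But a convolution with the kernel of
rate `κ` is also a convolution with the kernel of rate `κ'`, if `κ' - κ` times the result is added
to the source: with the right `κ'` the unknown drops out of the source, which then converges, to
`O + L = 1` times `λ` in the equation for `L` and to a combination of `lim O` and `lim L` in that
for `M`. The limit of the convolution is the limit of the source divided by `κ'`.
-/

noncomputable section

namespace Buffer

variable {E : Type*}

/-- Bounded measurable real functions, the test functions and weights of the whole argument. The
`MeasurableSpace` argument is often a history `hist Y H n` smaller than the ambient σ-algebra. -/
def IsBddMeasurable [MeasurableSpace E] (f : E → ℝ) : Prop :=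
  Measurable f ∧ ∃ K, 0 ≤ K ∧ ∀ x, |f x| ≤ K

namespace IsBddMeasurable

variable {m m' : MeasurableSpace E} {f g : E → ℝ}

lemma measurable (hf : IsBddMeasurable f) : Measurable f := hf.1

lemma exists_bound (hf : IsBddMeasurable f) : ∃ K, 0 ≤ K ∧ ∀ x, |f x| ≤ K := hf.2

lemma mono (hf : @IsBddMeasurable E m f) (hm : m ≤ m') : @IsBddMeasurable E m' f :=
  ⟨hf.1.mono hm le_rfl, hf.2⟩

lemma of_abs_le (hf : Measurable f) {K : ℝ} (hK : ∀ x, |f x| ≤ K) : IsBddMeasurable f :=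
  ⟨hf, |K|, abs_nonneg K, fun x => (hK x).trans (le_abs_self K)⟩

lemma const (c : ℝ) : IsBddMeasurable fun _ : E => c :=
  of_abs_le measurable_const fun _ => le_rfl

lemma add (hf : IsBddMeasurable f) (hg : IsBddMeasurable g) :
    IsBddMeasurable fun x => f x + g x := by
  obtain ⟨K, -, hK⟩ := hf.exists_bound
  obtain ⟨L, -, hL⟩ := hg.exists_bound
  exact of_abs_le (hf.measurable.add hg.measurable)
    fun x => (abs_add_le _ _).trans (add_le_add (hK x) (hL x))

lemma mul (hf : IsBddMeasurable f) (hg : IsBddMeasurable g) :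
    IsBddMeasurable fun x => f x * g x := by
  obtain ⟨K, hK0, hK⟩ := hf.exists_bound
  obtain ⟨L, -, hL⟩ := hg.exists_bound
  refine of_abs_le (hf.measurable.mul hg.measurable) (K := K * L) fun x => ?_
  rw [abs_mul]
  exact mul_le_mul (hK x) (hL x) (abs_nonneg _) hK0

lemma const_mul (hf : IsBddMeasurable f) (c : ℝ) : IsBddMeasurable fun x => c * f x :=
  (const c).mul hf

lemma integrable_mul (hf : IsBddMeasurable f) {μ : Measure E} (hg : Integrable g μ) :
    Integrable (fun x => f x * g x) μ := by
  obtain ⟨K, -, hK⟩ := hf.exists_bound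
  exact hg.bdd_mul hf.measurable.aestronglyMeasurable (Filter.Eventually.of_forall hK)

lemma integrable (hf : IsBddMeasurable f) (μ : Measure E) [IsFiniteMeasure μ] :
    Integrable f μ := by
  simpa only [mul_one] using hf.integrable_mul (integrable_const (1 : ℝ))

end IsBddMeasurable

section Decay

/-- The kernel `exp (-κ u)` of a decay at rate `κ` over a time `u ≥ 0`, continued by zero, so that
convolutions over the whole line only see the past. -/
def decay (κ u : ℝ) : ℝ := if 0 ≤ u then Real.exp (-(κ * u)) else 0

lemma decay_of_nonneg {κ u : ℝ} (hu : 0 ≤ u) : decay κ u = Real.exp (-(κ * u)) := if_pos hu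

lemma decay_of_neg {κ u : ℝ} (hu : u < 0) : decay κ u = 0 := if_neg hu.not_ge

lemma decay_nonneg (κ u : ℝ) : 0 ≤ decay κ u := by
  unfold decay
  split_ifs
  exacts [(Real.exp_pos _).le, le_rfl]

lemma decay_le_one {κ : ℝ} (hκ : 0 ≤ κ) (u : ℝ) : decay κ u ≤ 1 := by
  unfold decay
  split_ifs with hu
  · exact Real.exp_le_one_iff.2 (neg_nonpos.2 (mul_nonneg hκ hu))
  · exact zero_le_one

lemma abs_decay_le_one {κ : ℝ} (hκ : 0 ≤ κ) (u : ℝ) : |decay κ u| ≤ 1 := by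
  rw [abs_of_nonneg (decay_nonneg κ u)]
  exact decay_le_one hκ u

lemma decay_mul_decay (κ δ u : ℝ) : decay κ u * decay δ u = decay (κ + δ) u := by
  rcases lt_or_ge u 0 with hu | hu
  · simp only [decay_of_neg hu, mul_zero]
  · rw [decay_of_nonneg hu, decay_of_nonneg hu, decay_of_nonneg hu, ← Real.exp_add]
    ring_nf

@[fun_prop]
lemma measurable_decay (κ : ℝ) : Measurable (decay κ) :=
  Measurable.ite measurableSet_Ici (by fun_prop) measurable_const

lemma isBddMeasurable_decay {κ : ℝ} (hκ : 0 ≤ κ) : IsBddMeasurable (decay κ) :=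
  .of_abs_le (measurable_decay κ) (abs_decay_le_one hκ)

lemma isBddMeasurable_decay_comp [MeasurableSpace E] {κ : ℝ} (hκ : 0 ≤ κ) {g : E → ℝ}
    (hg : Measurable g) : IsBddMeasurable fun x => decay κ (g x) :=
  .of_abs_le ((measurable_decay κ).comp hg) fun _ => abs_decay_le_one hκ _

lemma integrable_decay {κ : ℝ} (hκ : 0 < κ) : Integrable (decay κ) := by
  have h : decay κ = Set.indicator (Set.Ici 0) (fun u => Real.exp (-κ * u)) := by
    ext u
    by_cases hu : 0 ≤ u <;> simp [decay, hu]
  rw [h, integrable_indicator_iff measurableSet_Ici, integrableOn_Ici_iff_integrableOn_Ioi]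
  exact exp_neg_integrableOn_Ioi 0 hκ

lemma integrable_decay_sub {κ : ℝ} (hκ : 0 < κ) (t : ℝ) :
    Integrable (fun s => decay κ (t - s)) :=
  (integrable_decay hκ).comp_sub_left t

lemma integral_expMeasure {r : ℝ} (hr : 0 < r) (g : ℝ → ℝ) :
    ∫ h, g h ∂(expMeasure r) = r * ∫ h, decay r h * g h := by
  have hpdf : gammaPDF 1 r = exponentialPDF r := rfl
  rw [expMeasure, gammaMeasure, hpdf, integral_withDensity_eq_integral_toReal_smul
    (show Measurable (exponentialPDF r) from (measurable_exponentialPDFReal r).ennreal_ofReal)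
    (Filter.Eventually.of_forall fun _ => ENNReal.ofReal_lt_top), ← integral_const_mul]
  congr 1 with h
  rw [exponentialPDF_eq, ENNReal.toReal_ofReal, smul_eq_mul, decay]
  · split_ifs <;> ring
  · split_ifs
    exacts [(mul_pos hr (Real.exp_pos _)).le, le_rfl]

lemma integral_decay {κ : ℝ} (hκ : 0 < κ) : ∫ u, decay κ u = 1 / κ := by
  have := isProbabilityMeasure_expMeasure hκ
  have h := integral_expMeasure hκ fun _ => 1
  simp only [integral_const, probReal_univ, smul_eq_mul, mul_one] at h
  rw [eq_div_iff hκ.ne', mul_comm, ← h]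

lemma expMeasure_Iio_zero (r : ℝ) : expMeasure r (Set.Iio 0) = 0 := by
  rw [expMeasure, gammaMeasure, withDensity_apply _ measurableSet_Iio]
  exact lintegral_gammaPDF_of_nonpos le_rfl

lemma integral_decay_expMeasure {r δ : ℝ} (hr : 0 < r) (hδ : 0 ≤ δ) :
    ∫ h, decay δ h ∂(expMeasure r) = r / (r + δ) := by
  simp only [integral_expMeasure hr, decay_mul_decay,
    integral_decay (add_pos_of_pos_of_nonneg hr hδ), mul_one_div]

lemma integral_indicator_Ioi_expMeasure {r : ℝ} (hr : 0 < r) {u : ℝ} (hu : 0 ≤ u) :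
    ∫ h, (Set.Ioi u).indicator (fun _ => (1 : ℝ)) h ∂(expMeasure r) = decay r u := by
  have := isProbabilityMeasure_expMeasure hr
  rw [integral_indicator measurableSet_Ioi, setIntegral_const, smul_eq_mul, mul_one,
    ← Set.compl_Iic, probReal_compl_eq_one_sub measurableSet_Iic, ← cdf_eq_real,
    cdf_expMeasure_eq hr, if_pos hu, decay_of_nonneg hu, sub_sub_cancel]

lemma sub_mul_integral_decay_mul_decay (κ κ' t u : ℝ) :
    (κ' - κ) * ∫ s, decay κ (s - u) * decay κ' (t - s) = decay κ (t - u) - decay κ' (t - u) := by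
  have hout : ∀ s ∉ Set.Icc u t, decay κ (s - u) * decay κ' (t - s) = 0 := fun s hs => by
    rcases lt_or_ge s u with hsu | hsu
    · rw [decay_of_neg (sub_neg.2 hsu), zero_mul]
    · rw [decay_of_neg (sub_neg.2 (lt_of_not_ge fun hst => hs ⟨hsu, hst⟩)), mul_zero]
  rw [← setIntegral_eq_integral_of_forall_compl_eq_zero hout]
  rcases lt_or_ge t u with htu | htu
  · rw [Set.Icc_eq_empty htu.not_ge, setIntegral_empty, mul_zero, decay_of_neg (sub_neg.2 htu),
      decay_of_neg (sub_neg.2 htu), sub_zero]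
  have hin : Set.EqOn (fun s => decay κ (s - u) * decay κ' (t - s))
      (fun s => Real.exp (-(κ * (s - u)) + -(κ' * (t - s)))) (Set.Icc u t) := fun s hs => by
    simp only [decay_of_nonneg (sub_nonneg.2 hs.1), decay_of_nonneg (sub_nonneg.2 hs.2),
      Real.exp_add]
  rw [setIntegral_congr_fun measurableSet_Icc hin, integral_Icc_eq_integral_Ioc,
    ← intervalIntegral.integral_of_le htu, ← intervalIntegral.integral_const_mul,
    intervalIntegral.integral_eq_sub_of_hasDerivAt
      (f := fun s => Real.exp (-(κ * (s - u)) + -(κ' * (t - s))))]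
  · rw [decay_of_nonneg (sub_nonneg.2 htu), decay_of_nonneg (sub_nonneg.2 htu)]
    simp only [sub_self, mul_zero, neg_zero, add_zero, zero_add]
  · intro s _
    have h : HasDerivAt (fun s => -(κ * (s - u)) + -(κ' * (t - s))) (κ' - κ) s := by
      have := (((hasDerivAt_id s).sub_const u).const_mul κ).neg.add
        (((hasDerivAt_id s).const_sub t).const_mul κ').neg
      convert! this using 1
      ring
    rw [mul_comm]
    exact h.exp
  · exact Continuous.intervalIntegrable (by fun_prop) _ _

end Decay

section Convolution

/-- The convolution of a source `h` with the decay kernel of rate `κ`. -/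
def decayConv (κ : ℝ) (h : ℝ → ℝ) (t : ℝ) : ℝ := ∫ s, h s * decay κ (t - s)

variable {κ κ' : ℝ} {f h x : ℝ → ℝ}

lemma integrable_mul_decay_sub (hκ : 0 < κ) (hh : IsBddMeasurable h) (t : ℝ) :
    Integrable fun s => h s * decay κ (t - s) :=
  hh.integrable_mul (integrable_decay_sub hκ t)

lemma decayConv_add (hκ : 0 < κ) (hf : IsBddMeasurable f) (hh : IsBddMeasurable h) (t : ℝ) :
    decayConv κ (fun s => f s + h s) t = decayConv κ f t + decayConv κ h t := by
  simp only [decayConv, add_mul]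
  exact integral_add (integrable_mul_decay_sub hκ hf t) (integrable_mul_decay_sub hκ hh t)

lemma decayConv_const_mul (κ c : ℝ) (h : ℝ → ℝ) (t : ℝ) :
    decayConv κ (fun s => c * h s) t = c * decayConv κ h t := by
  simp only [decayConv, mul_assoc, integral_const_mul]

lemma integrable_uncurry_mul_decay_mul_decay (hκ : 0 < κ) (hκ' : 0 < κ') (hh : IsBddMeasurable h)
    (t : ℝ) : Integrable (Function.uncurry fun s u =>
      h u * (decay κ (s - u) * decay κ' (t - s))) (volume.prod volume) := by
  have hkernel : Integrable (fun z : ℝ × ℝ => decay κ (z.1 - z.2) * decay κ' (t - z.1))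
      (volume.prod volume) := by
    rw [integrable_prod_iff (Measurable.aestronglyMeasurable (by fun_prop))]
    refine ⟨.of_forall fun s => (integrable_decay_sub hκ s).mul_const (decay κ' (t - s)), ?_⟩
    simp only [norm_mul, Real.norm_of_nonneg (decay_nonneg _ _), integral_mul_const,
      integral_sub_left_eq_self (decay κ) volume]
    exact (integrable_decay_sub hκ' t).const_mul _
  obtain ⟨K, -, hK⟩ := hh.exists_bound
  exact IsBddMeasurable.integrable_mul
    (.of_abs_le (hh.measurable.comp measurable_snd) fun z => hK z.2) hkernel

lemma sub_mul_decayConv_decayConv (hκ : 0 < κ) (hκ' : 0 < κ') (hh : IsBddMeasurable h) (t : ℝ) :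
    (κ' - κ) * decayConv κ' (decayConv κ h) t = decayConv κ h t - decayConv κ' h t := by
  have hswap : decayConv κ' (decayConv κ h) t =
      ∫ u, h u * ∫ s, decay κ (s - u) * decay κ' (t - s) := by
    simp only [decayConv, ← integral_mul_const, ← integral_const_mul, mul_assoc]
    exact integral_integral_swap (integrable_uncurry_mul_decay_mul_decay hκ hκ' hh t)
  rw [hswap, ← integral_const_mul]
  simp only [mul_left_comm (κ' - κ), sub_mul_integral_decay_mul_decay, mul_sub]
  exact integral_sub (integrable_mul_decay_sub hκ hh t) (integrable_mul_decay_sub hκ' hh t)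

lemma isBddMeasurable_decayConv (hκ : 0 < κ) (hh : IsBddMeasurable h) :
    IsBddMeasurable (decayConv κ h) := by
  have hm := hh.measurable
  obtain ⟨K, -, hK⟩ := hh.exists_bound
  have hkernel : StronglyMeasurable (Function.uncurry fun t s => h s * decay κ (t - s)) :=
    Measurable.stronglyMeasurable (by unfold Function.uncurry; fun_prop)
  have hmeas : Measurable (decayConv κ h) := hkernel.integral_prod_right.measurable
  refine .of_abs_le hmeas (K := K * (1 / κ)) fun t => ?_
  calc |decayConv κ h t| ≤ ∫ s, K * decay κ (t - s) := by
        rw [decayConv, ← Real.norm_eq_abs]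
        refine norm_integral_le_of_norm_le ((integrable_decay_sub hκ t).const_mul K)
          (.of_forall fun s => ?_)
        rw [norm_mul, Real.norm_of_nonneg (decay_nonneg _ _)]
        exact mul_le_mul_of_nonneg_right (hK s) (decay_nonneg _ _)
    _ = K * (1 / κ) := by
        rw [integral_const_mul, integral_sub_left_eq_self (decay κ) volume, integral_decay hκ]

lemma tendsto_decayConv (hκ : 0 < κ) (hh : IsBddMeasurable h) {l : ℝ}
    (hl : Filter.Tendsto h Filter.atTop (nhds l)) :
    Filter.Tendsto (decayConv κ h) Filter.atTop (nhds (l / κ)) := by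
  obtain ⟨K, -, hK⟩ := hh.exists_bound
  have hm := hh.measurable
  have hreflect : ∀ t, ∫ u, h (t - u) * decay κ u = decayConv κ h t := fun t => by
    rw [decayConv, ← integral_sub_left_eq_self (fun s => h s * decay κ (t - s)) volume t]
    simp only [sub_sub_cancel]
  rw [div_eq_mul_one_div, ← integral_decay hκ, ← integral_const_mul]
  refine Filter.Tendsto.congr hreflect ?_
  refine tendsto_integral_filter_of_dominated_convergence (fun u => K * decay κ u)
    (.of_forall fun t => Measurable.aestronglyMeasurable (by fun_prop))
    (.of_forall fun t => .of_forall fun u => ?_) ((integrable_decay hκ).const_mul K)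
    (.of_forall fun u => ?_)
  · rw [norm_mul, Real.norm_of_nonneg (decay_nonneg κ u)]
    exact mul_le_mul_of_nonneg_right (hK _) (decay_nonneg κ u)
  · exact (hl.comp (Filter.tendsto_atTop_add_const_right _ (-u) Filter.tendsto_id)).mul_const _

lemma tendsto_of_eq_decayConv (hκ : 0 < κ) (hκ' : 0 < κ') (hh : IsBddMeasurable h)
    (hx : x = decayConv κ h) {l : ℝ}
    (hl : Filter.Tendsto (fun s => h s + (κ' - κ) * x s) Filter.atTop (nhds l)) :
    Filter.Tendsto x Filter.atTop (nhds (l / κ')) := by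
  have hbdd : IsBddMeasurable x := hx ▸ isBddMeasurable_decayConv hκ hh
  have hshift : decayConv κ' (fun s => h s + (κ' - κ) * x s) = x := by
    funext t
    rw [decayConv_add hκ' hh (hbdd.const_mul _), decayConv_const_mul, hx,
      sub_mul_decayConv_decayConv hκ hκ' hh, add_sub_cancel]
  exact hshift ▸ tendsto_decayConv hκ' (hh.add (hbdd.const_mul _)) hl

end Convolution

section History

variable {S Ω : Type*}

/-- The event that the jump chain follows `y` up to step `n` and that the holding times before
step `n` lie in the sets `B k`. -/
def histCylinder (Y : ℕ → Ω → S) (H : ℕ → Ω → ℝ) (n : ℕ) (y : ℕ → S) (B : ℕ → Set ℝ) : Set Ω :=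
  {ω | (∀ k ≤ n, Y k ω = y k) ∧ ∀ k < n, H k ω ∈ B k}

/-- The π-system of measurable cylinders that generates the history at step `n`. -/
def histCylinders (Y : ℕ → Ω → S) (H : ℕ → Ω → ℝ) (n : ℕ) : Set (Set Ω) :=
  {A | ∃ (y : ℕ → S) (B : ℕ → Set ℝ), (∀ k, MeasurableSet (B k)) ∧ A = histCylinder Y H n y B}

/-- The history at step `n`: the σ-algebra of `Y 0, …, Y n` and `H 0, …, H (n - 1)`, which is the
information available when the `n`-th state is entered. -/
abbrev hist (Y : ℕ → Ω → S) (H : ℕ → Ω → ℝ) (n : ℕ) : MeasurableSpace Ω :=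
  MeasurableSpace.generateFrom (histCylinders Y H n)

lemma isPiSystem_histCylinders (Y : ℕ → Ω → S) (H : ℕ → Ω → ℝ) (n : ℕ) :
    IsPiSystem (histCylinders Y H n) := by
  rintro _ ⟨y, B, hB, rfl⟩ _ ⟨y', B', hB', rfl⟩ ⟨ω, hω, hω'⟩
  have hy : ∀ k ≤ n, y k = y' k := fun k hk => (hω.1 k hk).symm.trans (hω'.1 k hk)
  refine ⟨y, fun k => B k ∩ B' k, fun k => (hB k).inter (hB' k), Set.ext fun ω' => ⟨?_, ?_⟩⟩
  · rintro ⟨h, h'⟩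
    exact ⟨h.1, fun k hk => ⟨h.2 k hk, h'.2 k hk⟩⟩
  · rintro ⟨h, h'⟩
    exact ⟨⟨h, fun k hk => (h' k hk).1⟩, fun k hk => (h k hk).trans (hy k hk),
      fun k hk => (h' k hk).2⟩

lemma histCylinder_congr (Y : ℕ → Ω → S) (H : ℕ → Ω → ℝ) {n : ℕ} {y y' : ℕ → S}
    {B B' : ℕ → Set ℝ} (hy : ∀ k ≤ n, y k = y' k) (hB : ∀ k < n, B k = B' k) :
    histCylinder Y H n y B = histCylinder Y H n y' B' := by
  ext ω
  refine and_congr (forall₂_congr fun k hk => ?_) (forall₂_congr fun k hk => ?_)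
  · rw [hy k hk]
  · rw [hB k hk]

lemma histCylinder_succ (Y : ℕ → Ω → S) (H : ℕ → Ω → ℝ) (n : ℕ) (y : ℕ → S) (B : ℕ → Set ℝ) :
    histCylinder Y H (n + 1) y B =
      histCylinder Y H n y B ∩ {ω | H n ω ∈ B n} ∩ {ω | Y (n + 1) ω = y (n + 1)} := by
  ext ω
  simp only [histCylinder, Set.mem_inter_iff, Set.mem_ofPred_eq, Nat.forall_lt_succ_right,
    Nat.le_succ_iff, or_imp, forall_and, forall_eq]
  tauto

lemma setOf_forall_mem_eq_iUnion_histCylinder (Y : ℕ → Ω → S) (H : ℕ → Ω → ℝ) (n : ℕ)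
    (C : ℕ → Set S) (B : ℕ → Set ℝ) :
    {ω | (∀ k ≤ n, Y k ω ∈ C k) ∧ ∀ k < n, H k ω ∈ B k} =
      ⋃ y : {y : Fin (n + 1) → S // ∀ k : Fin (n + 1), y k ∈ C k},
        histCylinder Y H n (fun k => y.1 (Fin.ofNat (n + 1) k)) B := by
  have hval : ∀ k ≤ n, (Fin.ofNat (n + 1) k : ℕ) = k := fun k hk =>
    Nat.mod_eq_of_lt (Nat.lt_succ_of_le hk)
  ext ω
  simp only [Set.mem_iUnion, histCylinder, Set.mem_ofPred_eq]
  constructor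
  · rintro ⟨hY, hH⟩
    exact ⟨⟨fun k => Y k ω, fun k => hY k (Nat.le_of_lt_succ k.2)⟩,
      fun k hk => by simp only [hval k hk], hH⟩
  · rintro ⟨⟨y, hy⟩, hY, hH⟩
    refine ⟨fun k hk => ?_, hH⟩
    simpa only [hY k hk, hval k hk] using hy (Fin.ofNat (n + 1) k)

lemma measurableSet_histCylinder (Y : ℕ → Ω → S) (H : ℕ → Ω → ℝ) (n : ℕ) (y : ℕ → S)
    {B : ℕ → Set ℝ} (hB : ∀ k, MeasurableSet (B k)) :
    MeasurableSet[hist Y H n] (histCylinder Y H n y B) :=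
  MeasurableSpace.measurableSet_generateFrom ⟨y, B, hB, rfl⟩

lemma measurableSet_hist_forall_mem [Countable S] (Y : ℕ → Ω → S) (H : ℕ → Ω → ℝ) (n : ℕ)
    (C : ℕ → Set S) {B : ℕ → Set ℝ} (hB : ∀ k, MeasurableSet (B k)) :
    MeasurableSet[hist Y H n] {ω | (∀ k ≤ n, Y k ω ∈ C k) ∧ ∀ k < n, H k ω ∈ B k} := by
  rw [setOf_forall_mem_eq_iUnion_histCylinder]
  exact .iUnion fun y => measurableSet_histCylinder Y H n _ hB

lemma measurableSet_hist_mem [Countable S] (Y : ℕ → Ω → S) (H : ℕ → Ω → ℝ) {n k : ℕ} (hk : k ≤ n)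
    (C : Set S) : MeasurableSet[hist Y H n] {ω | Y k ω ∈ C} := by
  convert! measurableSet_hist_forall_mem Y H n (Function.update (fun _ => Set.univ) k C)
    (fun _ => MeasurableSet.univ) using 1
  ext ω
  simp only [Function.forall_update_iff _ fun j s => j ≤ n → Y j ω ∈ s, Set.mem_univ,
    Set.mem_ofPred_eq, hk, implies_true, and_true, true_imp_iff]

lemma measurable_hist_holdingTime [Countable S] (Y : ℕ → Ω → S) (H : ℕ → Ω → ℝ) {n k : ℕ}
    (hk : k < n) : Measurable[hist Y H n] (H k) := fun B hB => by
  convert! measurableSet_hist_forall_mem Y H n (fun _ => Set.univ)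
    (B := Function.update (fun _ => Set.univ) k B) ((Function.forall_update_iff _ _).2
      ⟨hB, fun _ _ => MeasurableSet.univ⟩) using 1
  ext ω
  simp only [Function.forall_update_iff _ fun j s => j < n → H j ω ∈ s, Set.mem_univ,
    Set.mem_ofPred_eq, Set.mem_preimage, hk, implies_true, and_true, true_and, true_imp_iff]

lemma hist_le_of_measurable {m : MeasurableSpace Ω} {Y : ℕ → Ω → S} {H : ℕ → Ω → ℝ} {n : ℕ}
    (hY : ∀ k ≤ n, ∀ x, MeasurableSet[m] {ω | Y k ω = x}) (hH : ∀ k < n, Measurable[m] (H k)) :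
    hist Y H n ≤ m := by
  refine MeasurableSpace.generateFrom_le ?_
  rintro _ ⟨y, B, hB, rfl⟩
  have hcyl : histCylinder Y H n y B =
      (⋂ k, ⋂ _ : k ≤ n, {ω | Y k ω = y k}) ∩ ⋂ k, ⋂ _ : k < n, H k ⁻¹' B k := by
    ext ω
    simp only [histCylinder, Set.mem_inter_iff, Set.mem_iInter, Set.mem_ofPred_eq,
      Set.mem_preimage]
  rw [hcyl]
  exact (MeasurableSet.iInter fun k => MeasurableSet.iInter fun hk => hY k hk _).inter
    (MeasurableSet.iInter fun k => MeasurableSet.iInter fun hk => hH k hk (hB k))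

lemma hist_le_succ [Countable S] (Y : ℕ → Ω → S) (H : ℕ → Ω → ℝ) (n : ℕ) :
    hist Y H n ≤ hist Y H (n + 1) :=
  hist_le_of_measurable (fun _ hk x => measurableSet_hist_mem Y H (Nat.le_succ_of_le hk) {x})
    (fun _ hk => measurable_hist_holdingTime Y H (Nat.lt_succ_of_lt hk))

lemma measurable_hist_jumpTime [Countable S] (Y : ℕ → Ω → S) (H : ℕ → Ω → ℝ) (n : ℕ) :
    Measurable[hist Y H n] (jumpTime H n) :=
  @Finset.measurable_sum _ _ _ _ _ _ (hist Y H n) _ (Finset.range n)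
    fun _ hk => measurable_hist_holdingTime Y H (Finset.mem_range.1 hk)

end History

section Independence

/-- All states of `C` are left at the same rate `r`, and towards `C'` at the same rate `ν`: seen
from `C`, the target `C'` is a single state of a lumped chain. -/
structure IsLumped {S : Type*} (R : S → S → ℝ) (C C' : Set S) (r ν : ℝ) : Prop where
  rate_pos : 0 < r
  exitRate_eq : ∀ x ∈ C, exitRate R x = r
  rate_nonneg : ∀ x ∈ C, ∀ x' ∈ C', 0 ≤ R x x'
  hasSum : ∀ x ∈ C, HasSum (fun x' : C' => R x x') ν

lemma IsLumped.tsum_jumpProb {S : Type*} {R : S → S → ℝ} {C C' : Set S} {r ν : ℝ}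
    (hL : IsLumped R C C' r ν) {x : S} (hx : x ∈ C) :
    ∑' x' : C', ENNReal.ofReal (jumpProb R x x') = ENNReal.ofReal (ν / r) := by
  have hsum : HasSum (fun x' : C' => jumpProb R x x') (ν / r) := by
    simpa only [jumpProb, hL.exitRate_eq x hx] using (hL.hasSum x hx).div_const r
  rw [← hsum.tsum_eq, ENNReal.ofReal_tsum_of_nonneg _ hsum.summable]
  intro x'
  rw [jumpProb, hL.exitRate_eq x hx]
  exact div_nonneg (hL.rate_nonneg x hx x' x'.2) hL.rate_pos.le

variable {S : Type*} [DecidableEq S] {Ω : Type*} [MeasurableSpace Ω] {R : S → S → ℝ} {x₀ : S}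
  {P : Measure Ω} {Y : ℕ → Ω → S} {H : ℕ → Ω → ℝ} {C C' : Set S} {r ν : ℝ}

lemma IsCTMC.hist_le (hC : IsCTMC R x₀ P Y H) (n : ℕ) : hist Y H n ≤ ‹MeasurableSpace Ω› :=
  hist_le_of_measurable (fun k _ x => hC.measurableSet_Y k x) (fun k _ => hC.measurable_H k)

lemma IsCTMC.measurable_jumpTime (hC : IsCTMC R x₀ P Y H) (n : ℕ) : Measurable (jumpTime H n) :=
  Finset.measurable_sum _ fun k _ => hC.measurable_H k

lemma IsCTMC.measurableSet_mem [Countable S] (hC : IsCTMC R x₀ P Y H) (n : ℕ) (C : Set S) :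
    MeasurableSet {ω | Y n ω ∈ C} :=
  hC.hist_le n _ (measurableSet_hist_mem Y H le_rfl C)

lemma IsCTMC.measure_histCylinder (hC : IsCTMC R x₀ P Y H) (hR : ∀ x, 0 < exitRate R x) (n : ℕ)
    (y : ℕ → S) {B : ℕ → Set ℝ} (hB : ∀ k, MeasurableSet (B k)) :
    P (histCylinder Y H n y B) = (if y 0 = x₀ then 1 else 0) *
        (∏ k ∈ Finset.range n, ENNReal.ofReal (jumpProb R (y k) (y (k + 1)))) *
        ∏ k ∈ Finset.range n, expMeasure (exitRate R (y k)) (B k) := by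
  have := isProbabilityMeasure_expMeasure (hR (y n))
  have hlaw := hC.law n y (Function.update B n Set.univ)
    ((Function.forall_update_iff _ fun _ s => MeasurableSet s).2 ⟨.univ, fun k _ => hB k⟩)
  have hset : {ω | ∀ k ≤ n, Y k ω = y k ∧ H k ω ∈ Function.update B n Set.univ k} =
      histCylinder Y H n y B := by
    ext ω
    simp only [forall_and, Function.forall_update_iff _ fun k s => k ≤ n → H k ω ∈ s,
      Set.mem_univ, implies_true, true_and, histCylinder, lt_iff_le_and_ne, and_imp,
      Set.mem_ofPred_eq]
    exact and_congr_right fun _ => forall_congr' fun _ => forall_comm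
  have hprod : ∏ k ∈ Finset.range n, expMeasure (exitRate R (y k)) (Function.update B n Set.univ k)
      = ∏ k ∈ Finset.range n, expMeasure (exitRate R (y k)) (B k) :=
    Finset.prod_congr rfl fun k hk => by
      rw [Function.update_of_ne (Finset.mem_range.1 hk).ne]
  rw [← hset, hlaw, Finset.prod_range_succ _ n, hprod, Function.update_self, measure_univ, mul_one]

lemma IsCTMC.measure_histCylinder_inter (hC : IsCTMC R x₀ P Y H) (hR : ∀ x, 0 < exitRate R x)
    (n : ℕ) (y : ℕ → S) {B : ℕ → Set ℝ} (hB : ∀ k, MeasurableSet (B k)) {D : Set ℝ}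
    (hD : MeasurableSet D) (x : S) :
    P (histCylinder Y H n y B ∩ {ω | H n ω ∈ D} ∩ {ω | Y (n + 1) ω = x}) =
      P (histCylinder Y H n y B) *
        (expMeasure (exitRate R (y n)) D * ENNReal.ofReal (jumpProb R (y n) x)) := by
  set y' := Function.update y (n + 1) x
  set B' := Function.update B n D
  have hB' : ∀ k, MeasurableSet (B' k) :=
    (Function.forall_update_iff _ fun _ s => MeasurableSet s).2 ⟨hD, fun k _ => hB k⟩
  have hy : ∀ k ≤ n, y k = y' k := fun k hk =>
    (Function.update_of_ne (Nat.lt_succ_of_le hk).ne _ _).symm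
  have hcongr := histCylinder_congr Y H hy (B := B) (B' := B')
    fun k hk => (Function.update_of_ne hk.ne _ _).symm
  have hx : y' (n + 1) = x := Function.update_self ..
  have hDn : B' n = D := Function.update_self ..
  have hsucc := histCylinder_succ Y H n y' B'
  rw [hx, hDn, ← hcongr] at hsucc
  rw [← hsucc, hcongr, hC.measure_histCylinder hR (n + 1) y' hB',
    hC.measure_histCylinder hR n y' hB', Finset.prod_range_succ _ n, Finset.prod_range_succ _ n,
    hx, hDn, hy n le_rfl]
  ring

lemma IsCTMC.measure_histCylinder_inter_mem [Countable S] (hC : IsCTMC R x₀ P Y H)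
    (hR : ∀ x, 0 < exitRate R x) (hL : IsLumped R C C' r ν) (n : ℕ) {D : Set ℝ}
    (hD : MeasurableSet D) (y : ℕ → S) {B : ℕ → Set ℝ} (hB : ∀ k, MeasurableSet (B k)) :
    P (histCylinder Y H n y B ∩ ({ω | Y n ω ∈ C} ∩ {ω | H n ω ∈ D} ∩ {ω | Y (n + 1) ω ∈ C'})) =
      P (histCylinder Y H n y B ∩ {ω | Y n ω ∈ C}) *
        (expMeasure r D * ENNReal.ofReal (ν / r)) := by
  rw [Set.inter_assoc {ω | Y n ω ∈ C}, ← Set.inter_assoc]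
  by_cases hy : y n ∈ C
  · have hcyl : histCylinder Y H n y B ∩ {ω | Y n ω ∈ C} = histCylinder Y H n y B :=
      Set.inter_eq_left.2 fun ω hω => by simpa only [Set.mem_ofPred_eq, hω.1 n le_rfl] using hy
    have hunion : histCylinder Y H n y B ∩ {ω | H n ω ∈ D} ∩ {ω | Y (n + 1) ω ∈ C'} =
        ⋃ x : C', histCylinder Y H n y B ∩ {ω | H n ω ∈ D} ∩ {ω | Y (n + 1) ω = x} := by
      ext ω
      simp
    rw [hcyl, ← Set.inter_assoc, hunion, measure_iUnion]
    · simp_rw [hC.measure_histCylinder_inter hR n y hB hD]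
      rw [ENNReal.tsum_mul_left, ENNReal.tsum_mul_left, hL.tsum_jumpProb hy, hL.exitRate_eq _ hy]
    · exact fun x x' hxx' => Set.disjoint_left.2 fun ω h h' =>
        hxx' (Subtype.ext (h.2.symm.trans h'.2))
    · exact fun x => ((hC.hist_le n _ (measurableSet_histCylinder Y H n y hB)).inter
        (hC.measurable_H n hD)).inter (hC.measurableSet_Y _ _)
  · have hcyl : histCylinder Y H n y B ∩ {ω | Y n ω ∈ C} = ∅ :=
      Set.eq_empty_of_forall_notMem fun ω hω => hy (hω.1.1 n le_rfl ▸ hω.2)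
    rw [hcyl, Set.empty_inter, measure_empty, zero_mul]

lemma IsCTMC.measure_inter [Countable S] [IsFiniteMeasure P] (hC : IsCTMC R x₀ P Y H)
    (hR : ∀ x, 0 < exitRate R x) (hL : IsLumped R C C' r ν) (n : ℕ) {D : Set ℝ}
    (hD : MeasurableSet D) {A : Set Ω} (hA : MeasurableSet[hist Y H n] A) :
    P (A ∩ ({ω | Y n ω ∈ C} ∩ {ω | H n ω ∈ D} ∩ {ω | Y (n + 1) ω ∈ C'})) =
      P (A ∩ {ω | Y n ω ∈ C}) * (expMeasure r D * ENNReal.ofReal (ν / r)) := by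
  have hm := hC.hist_le n
  set E := {ω | Y n ω ∈ C} ∩ {ω | H n ω ∈ D} ∩ {ω | Y (n + 1) ω ∈ C'}
  set c := expMeasure r D * ENNReal.ofReal (ν / r)
  suffices htrim : (P.restrict E).trim hm = c • (P.restrict {ω | Y n ω ∈ C}).trim hm by
    have h := congrArg (fun μ : @Measure Ω (hist Y H n) => μ A) htrim
    rwa [Measure.smul_apply, trim_measurableSet_eq hm hA, trim_measurableSet_eq hm hA,
      Measure.restrict_apply (hm _ hA), Measure.restrict_apply (hm _ hA), smul_eq_mul,
      mul_comm] at h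
  refine @Measure.ext_of_generateFrom_of_cover_subset _ (hist Y H n) _ _ (histCylinders Y H n)
    (Set.range fun y : {y : Fin (n + 1) → S // ∀ k, y k ∈ Set.univ} =>
      histCylinder Y H n (fun k => y.1 (Fin.ofNat (n + 1) k)) fun _ => Set.univ) rfl
    (isPiSystem_histCylinders Y H n) ?_ (Set.countable_range _) ?_ ?_ ?_
  · rintro _ ⟨y, rfl⟩
    exact ⟨_, _, fun _ => MeasurableSet.univ, rfl⟩
  · rw [Set.sUnion_range, ← setOf_forall_mem_eq_iUnion_histCylinder Y H n fun _ => Set.univ]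
    simp only [Set.mem_univ, implies_true, and_true, Set.ofPred_true]
  · exact fun s _ => measure_ne_top _ _
  · rintro _ ⟨y, B, hB, rfl⟩
    have hs := measurableSet_histCylinder Y H n y hB
    rw [Measure.smul_apply, trim_measurableSet_eq hm hs, trim_measurableSet_eq hm hs,
      Measure.restrict_apply (hm _ hs), Measure.restrict_apply (hm _ hs),
      hC.measure_histCylinder_inter_mem hR hL n hD y hB, smul_eq_mul, mul_comm]

variable {E : Type*} [MeasurableSpace E] {X : Ω → E}

lemma IsCTMC.map_prodMk [Countable S] [IsFiniteMeasure P] (hC : IsCTMC R x₀ P Y H)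
    (hR : ∀ x, 0 < exitRate R x) (hL : IsLumped R C C' r ν) (n : ℕ)
    (hX : Measurable[hist Y H n] X) :
    (P.restrict ({ω | Y n ω ∈ C} ∩ {ω | Y (n + 1) ω ∈ C'})).map (fun ω => (X ω, H n ω)) =
      ENNReal.ofReal (ν / r) • ((P.restrict {ω | Y n ω ∈ C}).map X).prod (expMeasure r) := by
  have hX' : Measurable X := hX.mono (hC.hist_le n) le_rfl
  have hXH : Measurable fun ω => (X ω, H n ω) := hX'.prodMk (hC.measurable_H n)
  have := isProbabilityMeasure_expMeasure hL.rate_pos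
  have : IsFiniteMeasure (ENNReal.ofReal (ν / r) • (P.restrict {ω | Y n ω ∈ C}).map X) :=
    Measure.smul_finite _ ENNReal.ofReal_ne_top
  rw [← Measure.prod_smul_left]
  refine (Measure.prod_eq fun s t hs ht => ?_).symm
  have hset : (fun ω => (X ω, H n ω)) ⁻¹' s ×ˢ t ∩ ({ω | Y n ω ∈ C} ∩ {ω | Y (n + 1) ω ∈ C'}) =
      X ⁻¹' s ∩ ({ω | Y n ω ∈ C} ∩ {ω | H n ω ∈ t} ∩ {ω | Y (n + 1) ω ∈ C'}) := by
    ext ω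
    simp only [Set.mem_inter_iff, Set.mem_preimage, Set.mem_prod, Set.mem_ofPred_eq]
    tauto
  rw [Measure.map_apply hXH (hs.prod ht), Measure.restrict_apply (hXH (hs.prod ht)),
    Measure.smul_apply, Measure.map_apply hX' hs, Measure.restrict_apply (hX' hs), hset,
    hC.measure_inter hR hL n ht (hX hs), smul_eq_mul]
  ring

lemma IsCTMC.setIntegral_prodMk [Countable S] [IsFiniteMeasure P] (hC : IsCTMC R x₀ P Y H)
    (hR : ∀ x, 0 < exitRate R x) (hL : IsLumped R C C' r ν) (n : ℕ)
    (hX : Measurable[hist Y H n] X) {f : E × ℝ → ℝ} (hf : Measurable f) {K : ℝ}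
    (hK : ∀ ω h, |f (X ω, h)| ≤ K) :
    ∫ ω in {ω | Y n ω ∈ C} ∩ {ω | Y (n + 1) ω ∈ C'}, f (X ω, H n ω) ∂P =
      ν / r * ∫ ω in {ω | Y n ω ∈ C}, ∫ h, f (X ω, h) ∂(expMeasure r) ∂P := by
  rcases C.eq_empty_or_nonempty with rfl | ⟨x, hx⟩
  · simp
  have hν : 0 ≤ ν := (hL.hasSum x hx).nonneg fun x' : C' => hL.rate_nonneg x hx x' x'.2
  have hX' : Measurable X := hX.mono (hC.hist_le n) le_rfl
  have := isProbabilityMeasure_expMeasure hL.rate_pos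
  have hprod : ((P.restrict {ω | Y n ω ∈ C}).map X).prod (expMeasure r) =
      ((P.restrict {ω | Y n ω ∈ C}).prod (expMeasure r)).map (Prod.map X id) := by
    rw [← Measure.map_prod_map _ _ hX' measurable_id, Measure.map_id]
  have hint : Integrable (fun z : Ω × ℝ => f (Prod.map X id z))
      ((P.restrict {ω | Y n ω ∈ C}).prod (expMeasure r)) :=
    .of_bound (hf.comp (hX'.prodMap measurable_id)).aestronglyMeasurable K
      (.of_forall fun z => hK z.1 z.2)
  rw [← integral_map (φ := fun ω => (X ω, H n ω)) (f := f)
    (hX'.prodMk (hC.measurable_H n)).aemeasurable hf.aestronglyMeasurable,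
    hC.map_prodMk hR hL n hX, integral_smul_measure,
    ENNReal.toReal_ofReal (div_nonneg hν hL.rate_pos.le), smul_eq_mul, hprod,
    integral_map (hX'.prodMap measurable_id).aemeasurable hf.aestronglyMeasurable,
    integral_prod _ hint]
  rfl

end Independence

section AlmostSure

/-- Nonnegative transition rates whose exit rates are positive and bounded, so that the chain
neither gets absorbed nor explodes. -/
structure IsRegularRate {S : Type*} (R : S → S → ℝ) : Prop where
  nonneg : ∀ x y, 0 ≤ R x y
  exitRate_pos : ∀ x, 0 < exitRate R x
  exists_exitRate_le : ∃ B, ∀ x, exitRate R x ≤ B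

lemma isLumped_univ {S : Type*} {R : S → S → ℝ} {C : Set S} {r : ℝ} (hr : 0 < r)
    (hnonneg : ∀ x ∈ C, ∀ y, 0 ≤ R x y) (hexit : ∀ x ∈ C, exitRate R x = r) :
    IsLumped R C Set.univ r r where
  rate_pos := hr
  exitRate_eq := hexit
  rate_nonneg x hx y _ := hnonneg x hx y
  hasSum x hx := by
    have hsummable : Summable (R x) := by
      by_contra h
      exact hr.ne' ((hexit x hx).symm.trans (tsum_eq_zero_of_not_summable h))
    have h := hsummable.hasSum
    rw [← exitRate, hexit x hx] at h
    exact (Equiv.Set.univ S).hasSum_iff.2 h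

lemma IsRegularRate.isLumped_singleton_univ {S : Type*} {R : S → S → ℝ} (hR : IsRegularRate R)
    (x : S) : IsLumped R {x} Set.univ (exitRate R x) (exitRate R x) :=
  isLumped_univ (hR.exitRate_pos x) (fun _ _ y => hR.nonneg _ y)
    fun y hy => by rw [Set.mem_singleton_iff.1 hy]

lemma IsRegularRate.isLumped_singleton {S : Type*} {R : S → S → ℝ} (hR : IsRegularRate R)
    (x x' : S) : IsLumped R {x} {x'} (exitRate R x) (R x x') where
  rate_pos := hR.exitRate_pos x
  exitRate_eq y hy := by rw [Set.mem_singleton_iff.1 hy]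
  rate_nonneg _ _ _ _ := hR.nonneg _ _
  hasSum y hy := by
    rw [Set.mem_singleton_iff.1 hy]
    exact hasSum_unique fun y' : ({x'} : Set S) => R x y'

variable {S : Type*} [DecidableEq S] {Ω : Type*} [MeasurableSpace Ω] {R : S → S → ℝ} {x₀ : S}
  {P : Measure Ω} {Y : ℕ → Ω → S} {H : ℕ → Ω → ℝ}

lemma IsCTMC.ae_start [IsProbabilityMeasure P] (hC : IsCTMC R x₀ P Y H)
    (hR : ∀ x, 0 < exitRate R x) : ∀ᵐ ω ∂P, Y 0 ω = x₀ := by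
  have h := hC.measure_histCylinder hR 0 (fun _ => x₀) (B := fun _ => Set.univ)
    fun _ => MeasurableSet.univ
  have hset : histCylinder Y H 0 (fun _ => x₀) (fun _ => Set.univ) = {ω | Y 0 ω = x₀} := by
    ext ω
    simp [histCylinder]
  rw [hset, if_pos rfl, Finset.prod_range_zero, Finset.prod_range_zero, mul_one, mul_one] at h
  exact (prob_compl_eq_zero_iff (hC.measurableSet_Y 0 x₀)).2 h

lemma IsCTMC.ae_holdingTime_nonneg [Countable S] [IsFiniteMeasure P] (hC : IsCTMC R x₀ P Y H)
    (hR : IsRegularRate R) : ∀ᵐ ω ∂P, ∀ n, 0 ≤ H n ω := by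
  refine ae_all_iff.2 fun n => ?_
  have hnull : ∀ x, P ({ω | Y n ω = x} ∩ {ω | H n ω < 0}) = 0 := fun x => by
    have h := hC.measure_inter hR.exitRate_pos (hR.isLumped_singleton_univ x) n
      (measurableSet_Iio (a := (0 : ℝ))) (@MeasurableSet.univ _ (hist Y H n))
    rw [expMeasure_Iio_zero, zero_mul, mul_zero] at h
    refine measure_mono_null (fun ω hω => ?_) h
    exact ⟨trivial, hω, trivial⟩
  refine measure_mono_null (fun ω (hω : ¬ 0 ≤ H n ω) => ?_) (measure_iUnion_null hnull)
  exact Set.mem_iUnion.2 ⟨Y n ω, rfl, not_le.1 hω⟩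

lemma IsCTMC.ae_rate_pos [Countable S] [IsFiniteMeasure P] (hC : IsCTMC R x₀ P Y H)
    (hR : IsRegularRate R) : ∀ᵐ ω ∂P, ∀ n, 0 < R (Y n ω) (Y (n + 1) ω) := by
  refine ae_all_iff.2 fun n => ?_
  have hnull : ∀ x x', ¬ 0 < R x x' → P ({ω | Y n ω = x} ∩ {ω | Y (n + 1) ω = x'}) = 0 := by
    intro x x' hx
    have h := hC.measure_inter hR.exitRate_pos (hR.isLumped_singleton x x') n MeasurableSet.univ
      (@MeasurableSet.univ _ (hist Y H n))
    rw [le_antisymm (not_lt.1 hx) (hR.nonneg x x'), zero_div, ENNReal.ofReal_zero, mul_zero,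
      mul_zero] at h
    refine measure_mono_null (fun ω hω => ?_) h
    exact ⟨trivial, ⟨hω.1, trivial⟩, hω.2⟩
  refine measure_mono_null (fun ω hω => ?_) (measure_iUnion_null fun x : S =>
    measure_iUnion_null fun x' : S => measure_iUnion_null fun hx => hnull x x' hx)
  simp only [Set.mem_iUnion]
  exact ⟨Y n ω, Y (n + 1) ω, hω, rfl, rfl⟩

end AlmostSure

section NonExplosion

variable {S Ω : Type*}

lemma prod_decay_eq {H : ℕ → Ω → ℝ} {ω : Ω} (hH : ∀ n, 0 ≤ H n ω) (n : ℕ) :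
    ∏ k ∈ Finset.range n, decay 1 (H k ω) = Real.exp (-jumpTime H n ω) := by
  simp only [decay_of_nonneg (hH _), one_mul, ← Real.exp_sum, Finset.sum_neg_distrib, jumpTime]

lemma measurable_hist_prod_decay [Countable S] (Y : ℕ → Ω → S) (H : ℕ → Ω → ℝ) (n : ℕ) :
    Measurable[hist Y H n] fun ω => ∏ k ∈ Finset.range n, decay 1 (H k ω) :=
  @Finset.measurable_fun_prod _ _ _ _ _ _ (hist Y H n) _ (Finset.range n) fun _ hk =>
    (measurable_decay 1).comp (measurable_hist_holdingTime Y H (Finset.mem_range.1 hk))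

lemma prod_decay_mem_Icc (H : ℕ → Ω → ℝ) (n : ℕ) (ω : Ω) :
    ∏ k ∈ Finset.range n, decay 1 (H k ω) ∈ Set.Icc 0 1 :=
  ⟨Finset.prod_nonneg fun _ _ => decay_nonneg _ _,
    Finset.prod_le_one (fun _ _ => decay_nonneg _ _) fun _ _ => decay_le_one zero_le_one _⟩

variable [DecidableEq S] [Countable S] [MeasurableSpace Ω] {R : S → S → ℝ} {x₀ : S}
  {P : Measure Ω} {Y : ℕ → Ω → S} {H : ℕ → Ω → ℝ}

lemma IsCTMC.isBddMeasurable_prod_decay (hC : IsCTMC R x₀ P Y H) (n : ℕ) :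
    IsBddMeasurable fun ω => ∏ k ∈ Finset.range n, decay 1 (H k ω) :=
  .of_abs_le ((measurable_hist_prod_decay Y H n).mono (hC.hist_le n) le_rfl) (K := 1) fun ω => by
    rw [abs_of_nonneg (prod_decay_mem_Icc H n ω).1]
    exact (prod_decay_mem_Icc H n ω).2

lemma IsCTMC.setIntegral_prod_decay_succ [IsFiniteMeasure P] (hC : IsCTMC R x₀ P Y H)
    (hR : IsRegularRate R) (n : ℕ) (x : S) :
    ∫ ω in {ω | Y n ω = x}, ∏ k ∈ Finset.range (n + 1), decay 1 (H k ω) ∂P =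
      exitRate R x / (exitRate R x + 1) *
        ∫ ω in {ω | Y n ω = x}, ∏ k ∈ Finset.range n, decay 1 (H k ω) ∂P := by
  have h := hC.setIntegral_prodMk hR.exitRate_pos (hR.isLumped_singleton_univ x) n
    (measurable_hist_prod_decay Y H n) (f := fun z => z.1 * decay 1 z.2) (by fun_prop) (K := 1)
    fun ω h => by
      rw [abs_of_nonneg (mul_nonneg (prod_decay_mem_Icc H n ω).1 (decay_nonneg 1 h))]
      exact mul_le_one₀ (prod_decay_mem_Icc H n ω).2 (decay_nonneg 1 h)
        (decay_le_one zero_le_one h)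
  simp only [Set.mem_singleton_iff, Set.mem_univ, Set.ofPred_true, Set.inter_univ,
    integral_const_mul, integral_decay_expMeasure (hR.exitRate_pos x) zero_le_one,
    integral_mul_const, div_self (hR.exitRate_pos x).ne', one_mul] at h
  simpa only [Finset.prod_range_succ, mul_comm] using h

lemma IsCTMC.integral_prod_decay_succ_le [IsFiniteMeasure P] (hC : IsCTMC R x₀ P Y H)
    (hR : IsRegularRate R) {B : ℝ} (hB : ∀ x, exitRate R x ≤ B) (n : ℕ) :
    ∫ ω, ∏ k ∈ Finset.range (n + 1), decay 1 (H k ω) ∂P ≤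
      B / (B + 1) * ∫ ω, ∏ k ∈ Finset.range n, decay 1 (H k ω) ∂P := by
  have hsplit : ∀ f : Ω → ℝ, IsBddMeasurable f →
      HasSum (fun x => ∫ ω in {ω | Y n ω = x}, f ω ∂P) (∫ ω, f ω ∂P) := fun f hf => by
    have hunion : ⋃ x, {ω | Y n ω = x} = Set.univ :=
      Set.iUnion_eq_univ_iff.2 fun ω => ⟨Y n ω, rfl⟩
    have h := hasSum_integral_iUnion (μ := P) (f := f) (hC.measurableSet_Y n)
      (fun x x' hxx' => Set.disjoint_left.2 fun ω hx hx' => hxx' (hx.symm.trans hx'))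
      (hf.integrable P).integrableOn
    rwa [hunion, setIntegral_univ] at h
  have hsplit_n := hsplit _ (hC.isBddMeasurable_prod_decay n)
  refine hasSum_le (fun x => ?_) (hsplit _ (hC.isBddMeasurable_prod_decay (n + 1)))
    (hsplit_n.mul_left (B / (B + 1)))
  rw [hC.setIntegral_prod_decay_succ hR]
  have hx := hR.exitRate_pos x
  have hxB := hB x
  refine mul_le_mul_of_nonneg_right ?_ (integral_nonneg fun ω => (prod_decay_mem_Icc H n ω).1)
  rw [div_le_div_iff₀ (by linarith) (by linarith)]
  linarith

/-- The discounts `exp (-jumpTime n)` decrease, and their means decrease geometrically. -/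
lemma IsCTMC.ae_exists_lt_jumpTime [IsProbabilityMeasure P] (hC : IsCTMC R x₀ P Y H)
    (hR : IsRegularRate R) : ∀ᵐ ω ∂P, ∀ t, ∃ n, t < jumpTime H n ω := by
  obtain ⟨B, hB⟩ := hR.exists_exitRate_le
  have hBpos : 0 < B := (hR.exitRate_pos x₀).trans_le (hB x₀)
  have hratio : 0 ≤ B / (B + 1) := by positivity
  have hpow : ∀ n, ∫ ω, ∏ k ∈ Finset.range n, decay 1 (H k ω) ∂P ≤ (B / (B + 1)) ^ n := by
    intro n
    induction n with
    | zero => simp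
    | succ n ih =>
      rw [pow_succ']
      exact (hC.integral_prod_decay_succ_le hR hB n).trans (mul_le_mul_of_nonneg_left ih hratio)
  have hmean : Filter.Tendsto (fun n => ∫ ω, ∏ k ∈ Finset.range n, decay 1 (H k ω) ∂P)
      Filter.atTop (nhds (∫ _, 0 ∂P)) := by
    rw [integral_zero]
    exact squeeze_zero (fun n => integral_nonneg fun ω => (prod_decay_mem_Icc H n ω).1) hpow
      (tendsto_pow_atTop_nhds_zero_of_lt_one hratio ((div_lt_one (by linarith)).2 (by linarith)))
  have htendsto := tendsto_of_integral_tendsto_of_antitone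
    (fun n => (hC.isBddMeasurable_prod_decay n).integrable P) (integrable_zero _ _ _) hmean
    (.of_forall fun ω => antitone_nat_of_succ_le fun n => by
      rw [Finset.prod_range_succ]
      exact mul_le_of_le_one_right (prod_decay_mem_Icc H n ω).1 (decay_le_one zero_le_one _))
    (.of_forall fun ω n => (prod_decay_mem_Icc H n ω).1)
  filter_upwards [htendsto, hC.ae_holdingTime_nonneg hR] with ω hω hH t
  obtain ⟨n, hn⟩ := (hω.eventually_lt_const (Real.exp_pos (-t))).exists
  rw [prod_decay_eq hH, Real.exp_lt_exp, neg_lt_neg_iff] at hn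
  exact ⟨n, hn⟩

end NonExplosion

section Step

lemma integral_decay_mul_decay_expMeasure {r : ℝ} (hr : 0 < r) (δ κ τ t : ℝ) :
    ∫ h, decay δ h * decay κ (t - (τ + h)) ∂(expMeasure r) =
      r * ∫ s, decay (r + δ) (s - τ) * decay κ (t - s) := by
  rw [integral_expMeasure hr, ← integral_sub_right_eq_self _ τ]
  simp only [← mul_assoc, decay_mul_decay, add_sub_cancel]

variable {S : Type*} {Ω : Type*} [MeasurableSpace Ω]

/-- The mean over `{Y n ∈ C}` of the weight `W`, decayed at rate `κ` from the `n`-th jump to the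
time `t`. -/
def decayMean (P : Measure Ω) (Y : ℕ → Ω → S) (H : ℕ → Ω → ℝ) (n : ℕ) (C : Set S) (W : Ω → ℝ)
    (κ t : ℝ) : ℝ :=
  ∫ ω in {ω | Y n ω ∈ C}, W ω * decay κ (t - jumpTime H n ω) ∂P

variable [DecidableEq S] {R : S → S → ℝ} {x₀ : S} {P : Measure Ω} [IsFiniteMeasure P]
  {Y : ℕ → Ω → S} {H : ℕ → Ω → ℝ} {C C' : Set S} {r ν δ κ : ℝ}

lemma IsCTMC.measurable_decayMean (hC : IsCTMC R x₀ P Y H) (n : ℕ) (C : Set S) {W : Ω → ℝ}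
    (hW : Measurable W) (κ : ℝ) : Measurable (decayMean P Y H n C W κ) := by
  have := hC.measurable_jumpTime n
  have h : Measurable fun z : ℝ × Ω => W z.2 * decay κ (z.1 - jumpTime H n z.2) := by fun_prop
  exact (h.stronglyMeasurable.integral_prod_right' (ν := P.restrict {ω | Y n ω ∈ C})).measurable

lemma IsCTMC.decayConv_decayMean (hC : IsCTMC R x₀ P Y H) (n : ℕ) (C : Set S) {W : Ω → ℝ}
    (hW : IsBddMeasurable W) (hδ : 0 ≤ δ) (hκ : 0 < κ) (t : ℝ) :
    decayConv κ (decayMean P Y H n C W δ) t =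
      ∫ ω in {ω | Y n ω ∈ C},
        W ω * (∫ s, decay δ (s - jumpTime H n ω) * decay κ (t - s)) ∂P := by
  have hT := hC.measurable_jumpTime n
  have hint : Integrable (Function.uncurry fun (s : ℝ) (ω : Ω) =>
      W ω * decay δ (s - jumpTime H n ω) * decay κ (t - s))
      (volume.prod (P.restrict {ω | Y n ω ∈ C})) := by
    obtain ⟨K, -, hK⟩ := hW.exists_bound
    have hW' : IsBddMeasurable fun z : ℝ × Ω => W z.2 :=
      .of_abs_le (hW.measurable.comp measurable_snd) fun z => hK z.2
    exact (hW'.mul (isBddMeasurable_decay_comp hδ (by fun_prop))).integrable_mul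
      ((integrable_decay_sub hκ t).comp_fst _)
  simp only [decayConv, decayMean, ← integral_mul_const, ← integral_const_mul]
  rw [integral_integral_swap hint]
  simp only [mul_assoc]

variable [Countable S]

/-- A jump from `C` to `C'` at time `s` restarts the clock, so that the decays before and after
the jump are convolved over `s`. -/
lemma IsCTMC.setIntegral_decay_jumpTime_succ (hC : IsCTMC R x₀ P Y H)
    (hR : ∀ x, 0 < exitRate R x) (hL : IsLumped R C C' r ν) (n : ℕ) {W : Ω → ℝ}
    (hW : @IsBddMeasurable Ω (hist Y H n) W) (hδ : 0 ≤ δ) (hκ : 0 < κ) (t : ℝ) :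
    ∫ ω in {ω | Y n ω ∈ C} ∩ {ω | Y (n + 1) ω ∈ C'},
        W ω * decay δ (H n ω) * decay κ (t - jumpTime H (n + 1) ω) ∂P =
      ν * decayConv κ (decayMean P Y H n C W (r + δ)) t := by
  obtain ⟨K, hK0, hK⟩ := hW.exists_bound
  have h := hC.setIntegral_prodMk hR hL n (hW.measurable.prodMk (measurable_hist_jumpTime Y H n))
    (f := fun z => z.1.1 * (decay δ z.2 * decay κ (t - (z.1.2 + z.2)))) (by fun_prop) (K := K)
    fun ω h => by
      rw [abs_mul, abs_mul, ← mul_one K]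
      exact mul_le_mul (hK ω) (mul_le_one₀ (abs_decay_le_one hδ _) (abs_nonneg _)
        (abs_decay_le_one hκ.le _)) (by positivity) hK0
  rw [hC.decayConv_decayMean n C (hW.mono (hC.hist_le n))
    (add_nonneg hL.rate_pos.le hδ) hκ t]
  simp only [integral_const_mul, integral_decay_mul_decay_expMeasure hL.rate_pos,
    mul_left_comm _ r] at h
  rw [← mul_assoc, mul_div_cancel₀ _ hL.rate_pos.ne'] at h
  simpa only [jumpTime, Finset.sum_range_succ, mul_assoc] using h

lemma IsCTMC.setIntegral_lt_jumpTime_succ (hC : IsCTMC R x₀ P Y H) (hR : ∀ x, 0 < exitRate R x)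
    (hL : IsLumped R C Set.univ r r) (n : ℕ) {W : Ω → ℝ}
    (hW : @IsBddMeasurable Ω (hist Y H n) W) (hδ : 0 ≤ δ) (t : ℝ) :
    ∫ ω in {ω | Y n ω ∈ C} ∩ {ω | t < jumpTime H (n + 1) ω},
        W ω * decay δ (t - jumpTime H n ω) ∂P =
      decayMean P Y H n C W (r + δ) t := by
  obtain ⟨K, hK0, hK⟩ := hW.exists_bound
  have hmeas : Measurable fun z : (ℝ × ℝ) × ℝ =>
      (Set.Ioi (t - z.1.2)).indicator (fun _ => (1 : ℝ)) z.2 :=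
    measurable_const.indicator (measurableSet_lt (f := fun z : (ℝ × ℝ) × ℝ => t - z.1.2)
      (by fun_prop) measurable_snd)
  have h := hC.setIntegral_prodMk hR hL n (hW.measurable.prodMk (measurable_hist_jumpTime Y H n))
    (f := fun z => z.1.1 * (decay δ (t - z.1.2) *
      (Set.Ioi (t - z.1.2)).indicator (fun _ => (1 : ℝ)) z.2)) (by fun_prop) (K := K) fun ω h => by
      rw [abs_mul, abs_mul, ← mul_one K]
      refine mul_le_mul (hK ω) (mul_le_one₀ (abs_decay_le_one hδ _) (abs_nonneg _) ?_)
        (by positivity) hK0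
      exact (norm_indicator_le_norm_self (fun _ => (1 : ℝ)) h).trans_eq norm_one
  have hinner : ∀ u, decay δ u * ∫ h, (Set.Ioi u).indicator (fun _ => (1 : ℝ)) h ∂(expMeasure r) =
      decay (r + δ) u := fun u => by
    rcases lt_or_ge u 0 with hu | hu
    · rw [decay_of_neg hu, decay_of_neg hu, zero_mul]
    · rw [integral_indicator_Ioi_expMeasure hL.rate_pos hu, decay_mul_decay, add_comm]
  simp only [div_self hL.rate_pos.ne', one_mul, integral_const_mul, hinner, Set.mem_univ,
    Set.ofPred_true, Set.inter_univ] at h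
  rw [decayMean, ← h, ← setIntegral_indicator (measurableSet_lt measurable_const
    (hC.measurable_jumpTime (n + 1)))]
  refine integral_congr_ae (.of_forall fun ω => ?_)
  simp [Set.indicator, jumpTime, Finset.sum_range_succ, sub_lt_iff_lt_add']

end Step

section JumpCount

variable {S Ω : Type*} {Y : ℕ → Ω → S} {H : ℕ → Ω → ℝ} {ω : Ω} {t : ℝ}

lemma jumpTime_succ (H : ℕ → Ω → ℝ) (n : ℕ) (ω : Ω) :
    jumpTime H (n + 1) ω = jumpTime H n ω + H n ω :=
  Finset.sum_range_succ _ n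

lemma monotone_jumpTime (hH : ∀ n, 0 ≤ H n ω) : Monotone fun n => jumpTime H n ω :=
  monotone_nat_of_le_succ fun n => by
    rw [jumpTime_succ]
    exact le_add_of_nonneg_right (hH n)

lemma bddAbove_setOf_jumpTime_le (hH : ∀ n, 0 ≤ H n ω) (ht : ∃ m, t < jumpTime H m ω) :
    BddAbove {n | jumpTime H n ω ≤ t} := by
  obtain ⟨m, hm⟩ := ht
  exact ⟨m, fun n hn => ((monotone_jumpTime hH).reflect_lt (lt_of_le_of_lt hn hm)).le⟩

lemma jumpCount_eq_iff (hH : ∀ n, 0 ≤ H n ω) (ht : ∃ m, t < jumpTime H m ω) {n : ℕ}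
    (hn : jumpTime H n ω ≤ t) : jumpCount H t ω = n ↔ t < jumpTime H (n + 1) ω := by
  refine ⟨fun h => lt_of_not_ge fun hsucc => ?_, fun h => le_antisymm ?_ ?_⟩
  · have := le_csSup (bddAbove_setOf_jumpTime_le hH ht) hsucc
    rw [← jumpCount, h] at this
    exact Nat.not_succ_le_self n this
  · exact csSup_le ⟨n, hn⟩ fun m hm =>
      Nat.le_of_lt_succ ((monotone_jumpTime hH).reflect_lt (lt_of_le_of_lt hm h))
  · exact le_csSup (bddAbove_setOf_jumpTime_le hH ht) hn

lemma jumpTime_jumpCount_le (hH : ∀ n, 0 ≤ H n ω) (ht : ∃ m, t < jumpTime H m ω) (h0 : 0 ≤ t) :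
    jumpTime H (jumpCount H t ω) ω ≤ t :=
  Nat.sSup_mem (s := {n | jumpTime H n ω ≤ t}) ⟨0, h0⟩ (bddAbove_setOf_jumpTime_le hH ht)

lemma jumpCount_of_neg (hH : ∀ n, 0 ≤ H n ω) (ht : t < 0) : jumpCount H t ω = 0 := by
  have hempty : {n | jumpTime H n ω ≤ t} = ∅ := Set.eq_empty_of_forall_notMem fun n hn =>
    (ht.trans_le (monotone_jumpTime hH (Nat.zero_le n))).not_ge hn
  rw [jumpCount, hempty, csSup_empty, bot_eq_zero]

lemma jumpCount_eq_iSup (H : ℕ → Ω → ℝ) (t : ℝ) (ω : Ω) :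
    jumpCount H t ω = ⨆ n, {ω | jumpTime H n ω ≤ t}.indicator (fun _ => n) ω := by
  set s := {n | jumpTime H n ω ≤ t}
  set g : ℕ → ℕ := fun n => {ω | jumpTime H n ω ≤ t}.indicator (fun _ => n) ω
  have hmem : ∀ n ∈ s, g n = n := fun n hn =>
    Set.indicator_of_mem (s := {ω | jumpTime H n ω ≤ t}) hn _
  have hsub : s ⊆ Set.range g := fun n hn => ⟨n, hmem n hn⟩
  change sSup s = sSup (Set.range g)
  by_cases hs : BddAbove s
  · have hub : sSup s ∈ upperBounds (Set.range g) := by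
      rintro _ ⟨n, rfl⟩
      exact Set.indicator_apply_le' (fun hn => le_csSup hs hn) fun _ => Nat.zero_le _
    exact le_antisymm (csSup_le_csSup' ⟨_, hub⟩ hsub) (csSup_le' hub)
  · rw [csSup_of_not_bddAbove hs, csSup_of_not_bddAbove fun h => hs (h.mono hsub)]

variable [DecidableEq S] [MeasurableSpace Ω] {R : S → S → ℝ} {x₀ : S} {P : Measure Ω}

lemma IsCTMC.measurable_jumpCount (hC : IsCTMC R x₀ P Y H) (t : ℝ) :
    Measurable (jumpCount H t) := by
  rw [funext (jumpCount_eq_iSup H t)]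
  exact Measurable.iSup fun n => measurable_const.indicator
    (measurableSet_le (hC.measurable_jumpTime n) measurable_const)

lemma IsCTMC.measurable_comp_jumpCount {E : Type*} [MeasurableSpace E] (hC : IsCTMC R x₀ P Y H)
    {f : ℕ → Ω → E} (hf : ∀ n, Measurable (f n)) (t : ℝ) :
    Measurable fun ω => f (jumpCount H t ω) ω :=
  (measurable_from_prod_countable_right (f := fun z : ℕ × Ω => f z.1 z.2) hf).comp
    ((hC.measurable_jumpCount t).prodMk measurable_id)

lemma IsCTMC.measurableSet_stateAt_mem [Countable S] (hC : IsCTMC R x₀ P Y H) (t : ℝ)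
    (C : Set S) : MeasurableSet {ω | stateAt Y H t ω ∈ C} :=
  measurableSet_setOfPred.2 (hC.measurable_comp_jumpCount
    (fun n => measurableSet_setOfPred.1 (hC.measurableSet_mem n C)) t)

end JumpCount

section AgedMean

variable {S Ω : Type*}

/-- A uniformly bounded sequence of weights, the `n`-th of which is known when the `n`-th state is
entered. -/
def IsBddAdapted (Y : ℕ → Ω → S) (H : ℕ → Ω → ℝ) (V : ℕ → Ω → ℝ) : Prop :=
  (∀ n, Measurable[hist Y H n] (V n)) ∧ ∃ K, 0 ≤ K ∧ ∀ n ω, |V n ω| ≤ K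

/-- The mean over `{stateAt t ∈ C}` of the weight with which the current state was entered, decayed
at rate `δ` since then. -/
def agedMean [MeasurableSpace Ω] (P : Measure Ω) (Y : ℕ → Ω → S) (H : ℕ → Ω → ℝ) (C : Set S)
    (V : ℕ → Ω → ℝ) (δ t : ℝ) : ℝ :=
  ∫ ω in {ω | stateAt Y H t ω ∈ C},
    V (jumpCount H t ω) ω * decay δ (t - jumpTime H (jumpCount H t ω) ω) ∂P

variable {Y : ℕ → Ω → S} {H : ℕ → Ω → ℝ} {V : ℕ → Ω → ℝ}

lemma isBddAdapted_one (Y : ℕ → Ω → S) (H : ℕ → Ω → ℝ) : IsBddAdapted Y H fun _ _ => 1 :=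
  ⟨fun _ => measurable_const, 1, zero_le_one, fun _ _ => abs_one.le⟩

lemma IsBddAdapted.isBddMeasurable (hV : IsBddAdapted Y H V) (n : ℕ) :
    @IsBddMeasurable Ω (hist Y H n) (V n) := by
  obtain ⟨hmeas, K, hK0, hK⟩ := hV
  exact ⟨hmeas n, K, hK0, hK n⟩

variable [DecidableEq S] [MeasurableSpace Ω] {R : S → S → ℝ} {x₀ : S}
  {P : Measure Ω} {C : Set S} {r δ κ : ℝ}

lemma IsCTMC.isBddMeasurable_aged (hC : IsCTMC R x₀ P Y H) (hV : IsBddAdapted Y H V)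
    (hδ : 0 ≤ δ) (t : ℝ) : IsBddMeasurable fun ω =>
      V (jumpCount H t ω) ω * decay δ (t - jumpTime H (jumpCount H t ω) ω) := by
  obtain ⟨hmeas, K, -, hK⟩ := hV
  exact .mul (.of_abs_le (hC.measurable_comp_jumpCount
      (fun n => (hmeas n).mono (hC.hist_le n) le_rfl) t) fun ω => hK _ ω)
    (isBddMeasurable_decay_comp hδ
      ((hC.measurable_comp_jumpCount hC.measurable_jumpTime t).const_sub t))

variable [Countable S] [IsProbabilityMeasure P]

lemma IsCTMC.hasSum_decayMean (hC : IsCTMC R x₀ P Y H) (hR : IsRegularRate R)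
    (hL : IsLumped R C Set.univ r r) (hV : IsBddAdapted Y H V) (hδ : 0 ≤ δ) (t : ℝ) :
    HasSum (fun n => decayMean P Y H n C (V n) (r + δ) t) (agedMean P Y H C V δ t) := by
  have hmeas : ∀ n, MeasurableSet {ω | Y n ω ∈ C ∧ jumpCount H t ω = n} := fun n =>
    (hC.measurableSet_mem n C).inter (hC.measurable_jumpCount t (measurableSet_singleton n))
  have hunion : ⋃ n, {ω | Y n ω ∈ C ∧ jumpCount H t ω = n} = {ω | stateAt Y H t ω ∈ C} := by
    ext ω
    simp [stateAt]
  have h := hasSum_integral_iUnion (μ := P) hmeas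
    (fun m n hmn => Set.disjoint_left.2 fun ω hm hn => hmn (hm.2.symm.trans hn.2))
    ((hC.isBddMeasurable_aged hV hδ t).integrable P).integrableOn
  rw [hunion] at h
  refine h.congr_fun fun n => ?_
  rw [← hC.setIntegral_lt_jumpTime_succ hR.exitRate_pos hL n (hV.isBddMeasurable n) hδ t,
    ← integral_indicator (hmeas n), ← integral_indicator ((hC.measurableSet_mem n C).inter
      (measurableSet_lt measurable_const (hC.measurable_jumpTime (n + 1))))]
  refine integral_congr_ae ?_
  filter_upwards [hC.ae_holdingTime_nonneg hR, hC.ae_exists_lt_jumpTime hR] with ω hH hω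
  rcases lt_or_ge t (jumpTime H n ω) with hlt | hge
  · trans 0
    · exact Set.indicator_apply_eq_zero.2 fun _ => by rw [decay_of_neg (sub_neg.2 hlt), mul_zero]
    · refine (Set.indicator_apply_eq_zero.2 fun hω => ?_).symm
      rw [hω.2, decay_of_neg (sub_neg.2 hlt), mul_zero]
  · have hiff := jumpCount_eq_iff hH (hω t) hge
    classical
    simp only [Set.indicator_apply, Set.mem_inter_iff, Set.mem_ofPred_eq, ← hiff]
    split_ifs with hmem
    · rw [hmem.2]
    · rfl

lemma IsCTMC.isBddMeasurable_agedMean (hC : IsCTMC R x₀ P Y H) (hR : IsRegularRate R)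
    (hL : IsLumped R C Set.univ r r) (hV : IsBddAdapted Y H V) (hδ : 0 ≤ δ) :
    IsBddMeasurable (agedMean P Y H C V δ) := by
  obtain ⟨K, hK0, hK⟩ := hV.2
  have hmeas : Measurable (agedMean P Y H C V δ) :=
    measurable_of_tendsto_metrizable
      (fun N => Finset.measurable_fun_sum (Finset.range N) fun n _ => hC.measurable_decayMean n C
        ((hV.1 n).mono (hC.hist_le n) le_rfl) (r + δ))
      (tendsto_pi_nhds.2 fun t => (hC.hasSum_decayMean hR hL hV hδ t).tendsto_sum_nat)
  refine .of_abs_le hmeas (K := K) fun t => ?_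
  calc |agedMean P Y H C V δ t| ≤ K * P.real {ω | stateAt Y H t ω ∈ C} :=
        norm_setIntegral_le_of_norm_le_const (f := fun ω =>
          V (jumpCount H t ω) ω * decay δ (t - jumpTime H (jumpCount H t ω) ω))
          (measure_lt_top _ _) fun ω _ => by
          rw [norm_mul, ← mul_one K]
          exact mul_le_mul (hK _ _) (abs_decay_le_one hδ _) (norm_nonneg _) hK0
    _ ≤ K := mul_le_of_le_one_right hK0 measureReal_le_one

lemma IsCTMC.hasSum_decayConv_decayMean (hC : IsCTMC R x₀ P Y H) (hR : IsRegularRate R)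
    (hL : IsLumped R C Set.univ r r) (hV : IsBddAdapted Y H V) (hδ : 0 ≤ δ) (hκ : 0 < κ)
    (t : ℝ) :
    HasSum (fun n => decayConv κ (decayMean P Y H n C (V n) (r + δ)) t)
      (decayConv κ (agedMean P Y H C V δ) t) := by
  obtain ⟨K, -, hK⟩ := hV.2
  have hone := isBddAdapted_one Y H
  have hrδ : 0 ≤ r + δ := add_nonneg hL.rate_pos.le hδ
  have hbound : ∀ n s, |decayMean P Y H n C (V n) (r + δ) s| ≤
      K * decayMean P Y H n C (fun _ => 1) (r + δ) s := fun n s => by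
    rw [decayMean, decayMean, ← integral_const_mul]
    refine norm_integral_le_of_norm_le (f := fun ω => V n ω * decay (r + δ) (s - jumpTime H n ω))
      (IsBddMeasurable.integrable (.const_mul (.mul (.const _) (isBddMeasurable_decay_comp
        hrδ ((hC.measurable_jumpTime n).const_sub s))) K) _) (.of_forall fun ω => ?_)
    rw [norm_mul, one_mul, Real.norm_of_nonneg (decay_nonneg _ _)]
    exact mul_le_mul_of_nonneg_right (hK n ω) (decay_nonneg _ _)
  have hsum : ∀ s, HasSum
      (fun n => K * decayMean P Y H n C (fun _ => 1) (r + δ) s * decay κ (t - s))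
      (K * agedMean P Y H C (fun _ _ => 1) δ s * decay κ (t - s)) := fun s =>
    ((hC.hasSum_decayMean hR hL hone hδ s).mul_left K).mul_right _
  have hmeas := hC.isBddMeasurable_agedMean hR hL hone hδ
  refine hasSum_integral_of_dominated_convergence
    (fun n s => K * decayMean P Y H n C (fun _ => 1) (r + δ) s * decay κ (t - s))
    (fun n => ?_) (fun n => .of_forall fun s => ?_) (.of_forall fun s => (hsum s).summable) ?_
    (.of_forall fun s => (hC.hasSum_decayMean hR hL hV hδ s).mul_right _)
  · have := hC.measurable_decayMean n C ((hV.1 n).mono (hC.hist_le n) le_rfl) (P := P) (r + δ)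
    exact Measurable.aestronglyMeasurable (by fun_prop)
  · rw [norm_mul, Real.norm_of_nonneg (decay_nonneg _ _)]
    exact mul_le_mul_of_nonneg_right (hbound n s) (decay_nonneg _ _)
  · simp only [(hsum _).tsum_eq]
    exact integrable_mul_decay_sub hκ (hmeas.const_mul K) t

end AgedMean

section Rates

variable {lam mu q p : ℝ}

lemma exitRate_none : exitRate (bufferRate lam mu q p) none = lam := by
  rw [exitRate, tsum_eq_single (some 0)]
  · simp [bufferRate]
  · rintro (_ | j) hj
    · rfl
    · exact if_neg fun h => hj (congrArg some h)

lemma exitRate_some (i : ℕ) : exitRate (bufferRate lam mu q p) (some i) = mu + lam * q := by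
  rw [exitRate, tsum_eq_sum (s := {none, some (i + 1)})]
  · rw [Finset.sum_pair (Option.some_ne_none _).symm]
    simp only [bufferRate, if_true]
    ring
  · rintro (_ | j) hj
    · simp at hj
    · exact if_neg fun h => hj (by simp [h])

lemma isRegularRate_bufferRate (hlam : 0 < lam) (hβ : 0 < mu + lam * q * (1 - p))
    (hν : 0 ≤ lam * q * p) : IsRegularRate (bufferRate lam mu q p) where
  nonneg
    | none, none => le_rfl
    | none, some j => ite_nonneg hlam.le le_rfl
    | some _, none => hβ.le
    | some i, some j => ite_nonneg hν le_rfl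
  exitRate_pos
    | none => by rwa [exitRate_none]
    | some i => by rw [exitRate_some]; linarith
  exists_exitRate_le := ⟨max lam (mu + lam * q), fun
    | none => by rw [exitRate_none]; exact le_max_left _ _
    | some i => by rw [exitRate_some]; exact le_max_right _ _⟩

lemma isLumped_none_link (hlam : 0 < lam) :
    IsLumped (bufferRate lam mu q p) {none} {none}ᶜ lam lam where
  rate_pos := hlam
  exitRate_eq := by
    rintro _ rfl
    exact exitRate_none
  rate_nonneg := by
    rintro _ rfl (_ | j) -
    exacts [le_rfl, ite_nonneg hlam.le le_rfl]
  hasSum := by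
    rintro _ rfl
    refine hasSum_single (f := fun y : ({none}ᶜ : Set (Option ℕ)) => bufferRate lam mu q p none y)
      ⟨some 0, Option.some_ne_none 0⟩ ?_
    rintro ⟨_ | j, hj⟩ hne
    exacts [rfl, if_neg fun h => hne (by simp [h])]

lemma isLumped_link_link (hα : 0 < mu + lam * q) (hν : 0 ≤ lam * q * p) :
    IsLumped (bufferRate lam mu q p) {none}ᶜ {none}ᶜ (mu + lam * q) (lam * q * p) where
  rate_pos := hα
  exitRate_eq := by
    rintro (_ | i) hi
    exacts [absurd rfl hi, exitRate_some i]
  rate_nonneg := by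
    rintro (_ | i) hi (_ | j) hj
    exacts [le_rfl, absurd rfl hi, absurd rfl hj, ite_nonneg hν le_rfl]
  hasSum := by
    rintro (_ | i) hi
    · exact absurd rfl hi
    · have hrate : bufferRate lam mu q p (some i) (some (i + 1)) = lam * q * p := if_pos rfl
      rw [← hrate]
      refine hasSum_single
        (f := fun y : ({none}ᶜ : Set (Option ℕ)) => bufferRate lam mu q p (some i) y)
        ⟨some (i + 1), Option.some_ne_none _⟩ ?_
      rintro ⟨_ | j, hj⟩ hne
      exacts [absurd rfl hj, if_neg fun h => hne (by simp [h])]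

lemma isLumped_none_univ (hlam : 0 < lam) (hβ : 0 < mu + lam * q * (1 - p))
    (hν : 0 ≤ lam * q * p) : IsLumped (bufferRate lam mu q p) {none} Set.univ lam lam :=
  isLumped_univ hlam (fun x _ => (isRegularRate_bufferRate hlam hβ hν).nonneg x)
    (isLumped_none_link hlam).exitRate_eq

lemma isLumped_link_univ (hlam : 0 < lam) (hβ : 0 < mu + lam * q * (1 - p))
    (hν : 0 ≤ lam * q * p) :
    IsLumped (bufferRate lam mu q p) {none}ᶜ Set.univ (mu + lam * q) (mu + lam * q) := by
  have hα : 0 < mu + lam * q := by linarith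
  exact isLumped_univ hα (fun x _ => (isRegularRate_bufferRate hlam hβ hν).nonneg x)
    (isLumped_link_link hα hν).exitRate_eq

end Rates

section EntryExcess

variable {Ω : Type*} {Y : ℕ → Ω → Option ℕ} {H : ℕ → Ω → ℝ} {Γ a e u : ℝ}

/-- The excess over `1 / 4` of the fidelity of the link just after the `n`-th jump, provided that
there is a link then; `u` is the excess of a fresh link, and pumping turns an excess `x` into
`a * x + e`. -/
def entryExcess (Γ a e u : ℝ) (Y : ℕ → Ω → Option ℕ) (H : ℕ → Ω → ℝ) : ℕ → Ω → ℝ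
  | 0, _ => u
  | n + 1, ω =>
      if Y n ω = none then u else a * (decay Γ (H n ω) * entryExcess Γ a e u Y H n ω) + e

lemma entryExcess_zero_one_one (Γ : ℝ) (Y : ℕ → Ω → Option ℕ) (H : ℕ → Ω → ℝ) :
    entryExcess Γ 0 1 1 Y H = fun _ _ => 1 := by
  funext n ω
  cases n with
  | zero => rfl
  | succ n => rw [entryExcess, zero_mul, zero_add, ite_self]

lemma entryExcess_mem {I : Set ℝ} (hI : Convex ℝ I) (h0 : 0 ∈ I) (hu : u ∈ I)
    (hmaps : Set.MapsTo (fun x => a * x + e) I I) (hΓ : 0 ≤ Γ) (n : ℕ) (ω : Ω) :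
    entryExcess Γ a e u Y H n ω ∈ I := by
  induction n with
  | zero => exact hu
  | succ n ih =>
    rw [entryExcess]
    split_ifs
    · exact hu
    · exact hmaps (hI.smul_mem_of_zero_mem h0 ih ⟨decay_nonneg _ _, decay_le_one hΓ _⟩)

lemma measurable_hist_entryExcess (Γ a e u : ℝ) (Y : ℕ → Ω → Option ℕ) (H : ℕ → Ω → ℝ) (n : ℕ) :
    Measurable[hist Y H n] (entryExcess Γ a e u Y H n) := by
  induction n with
  | zero => exact measurable_const
  | succ n ih =>
    let _ := hist Y H (n + 1)
    have hV : Measurable (entryExcess Γ a e u Y H n) := ih.mono (hist_le_succ Y H n) le_rfl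
    have hH : Measurable (H n) := measurable_hist_holdingTime Y H n.lt_succ_self
    exact Measurable.ite (measurableSet_hist_mem Y H n.le_succ {none}) measurable_const
      (by fun_prop : Measurable fun ω => a * (decay Γ (H n ω) * entryExcess Γ a e u Y H n ω) + e)

lemma isBddAdapted_entryExcess {I : Set ℝ} (hI : Convex ℝ I) (hbdd : Bornology.IsBounded I)
    (h0 : 0 ∈ I) (hu : u ∈ I) (hmaps : Set.MapsTo (fun x => a * x + e) I I) (hΓ : 0 ≤ Γ) :
    IsBddAdapted Y H (entryExcess Γ a e u Y H) := by
  obtain ⟨K, hK⟩ := hbdd.exists_norm_le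
  exact ⟨measurable_hist_entryExcess Γ a e u Y H, K, (norm_nonneg _).trans (hK 0 h0),
    fun n ω => hK _ (entryExcess_mem hI h0 hu hmaps hΓ n ω)⟩

end EntryExcess

section SplitAtJump

variable {S Ω : Type*} [DecidableEq S] [MeasurableSpace Ω] {R : S → S → ℝ} {x₀ : S}
  {P : Measure Ω} [IsProbabilityMeasure P] {Y : ℕ → Ω → S} {H : ℕ → Ω → ℝ} {C C' : Set S}
  {W : Ω → ℝ} {r ν κ : ℝ} [Countable S]

lemma IsCTMC.decayMean_succ (hC : IsCTMC R x₀ P Y H) (hW : IsBddMeasurable W) (hκ : 0 ≤ κ)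
    (n : ℕ) (C : Set S) (t : ℝ) :
    decayMean P Y H (n + 1) C' W κ t =
      (∫ ω in {ω | Y n ω ∈ C} ∩ {ω | Y (n + 1) ω ∈ C'},
        W ω * decay κ (t - jumpTime H (n + 1) ω) ∂P) +
      ∫ ω in {ω | Y n ω ∈ Cᶜ} ∩ {ω | Y (n + 1) ω ∈ C'},
        W ω * decay κ (t - jumpTime H (n + 1) ω) ∂P := by
  have hint : IsBddMeasurable fun ω => W ω * decay κ (t - jumpTime H (n + 1) ω) :=
    hW.mul (isBddMeasurable_decay_comp hκ ((hC.measurable_jumpTime (n + 1)).const_sub t))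
  rw [decayMean, ← integral_inter_add_sdiff (hC.measurableSet_mem n C)
    (hint.integrable P).integrableOn, Set.sdiff_eq]
  simp only [Set.inter_comm {ω | Y (n + 1) ω ∈ C'}]
  rfl

lemma IsCTMC.setIntegral_jumpTime_succ (hC : IsCTMC R x₀ P Y H) (hR : IsRegularRate R)
    (hL : IsLumped R C C' r ν) (n : ℕ) (hW : @IsBddMeasurable Ω (hist Y H n) W) (hκ : 0 < κ)
    (t : ℝ) :
    ∫ ω in {ω | Y n ω ∈ C} ∩ {ω | Y (n + 1) ω ∈ C'},
        W ω * decay κ (t - jumpTime H (n + 1) ω) ∂P =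
      ν * decayConv κ (decayMean P Y H n C W r) t := by
  have h := hC.setIntegral_decay_jumpTime_succ hR.exitRate_pos hL n hW le_rfl hκ t
  rw [add_zero] at h
  refine Eq.trans (integral_congr_ae (ae_restrict_of_ae ?_)) h
  filter_upwards [hC.ae_holdingTime_nonneg hR] with ω hω
  rw [decay_of_nonneg (hω n), zero_mul, neg_zero, Real.exp_zero, mul_one]

end SplitAtJump

section Recursion

variable {Ω : Type*} [MeasurableSpace Ω] {P : Measure Ω} [IsProbabilityMeasure P]
  {Y : ℕ → Ω → Option ℕ} {H : ℕ → Ω → ℝ} {lam mu q p Γ a e u : ℝ}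

lemma Is1G1B.decayMean_link_zero (hsys : Is1G1B lam mu q p P Y H)
    (hR : IsRegularRate (bufferRate lam mu q p)) (W : Ω → ℝ) (κ t : ℝ) :
    decayMean P Y H 0 {none}ᶜ W κ t = 0 :=
  setIntegral_measure_zero _
    (measure_mono_null (fun _ hω h => hω h) (IsCTMC.ae_start hsys hR.exitRate_pos))

lemma Is1G1B.decayMean_entryExcess_succ (hsys : Is1G1B lam mu q p P Y H) (hlam : 0 < lam)
    (hβ : 0 < mu + lam * q * (1 - p)) (hν : 0 ≤ lam * q * p)
    (hV : IsBddAdapted Y H (entryExcess Γ a e u Y H)) (hΓ : 0 ≤ Γ) (n : ℕ) (t : ℝ) :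
    decayMean P Y H (n + 1) {none}ᶜ (entryExcess Γ a e u Y H (n + 1)) (mu + lam * q + Γ) t =
      u * (lam * decayConv (mu + lam * q + Γ) (decayMean P Y H n {none} (fun _ => 1) lam) t) +
      lam * q * p * (a * decayConv (mu + lam * q + Γ) (decayMean P Y H n {none}ᶜ
          (entryExcess Γ a e u Y H n) (mu + lam * q + Γ)) t +
        e * decayConv (mu + lam * q + Γ)
          (decayMean P Y H n {none}ᶜ (fun _ => 1) (mu + lam * q)) t) := by
  have hC : IsCTMC _ _ P Y H := hsys
  have hR := isRegularRate_bufferRate hlam hβ hν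
  have hα : 0 < mu + lam * q := by linarith
  have hκ : 0 < mu + lam * q + Γ := by linarith
  have hbdd : ∀ n, IsBddMeasurable (entryExcess Γ a e u Y H n) := fun n =>
    (hV.isBddMeasurable n).mono (hC.hist_le n)
  have hset : ∀ C C' : Set (Option ℕ),
      MeasurableSet ({ω | Y n ω ∈ C} ∩ {ω | Y (n + 1) ω ∈ C'}) := fun C C' =>
    (hC.measurableSet_mem n C).inter (hC.measurableSet_mem (n + 1) C')
  have hlast : IsBddMeasurable fun ω => decay (mu + lam * q + Γ) (t - jumpTime H (n + 1) ω) :=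
    isBddMeasurable_decay_comp hκ.le ((hC.measurable_jumpTime (n + 1)).const_sub t)
  have hheld : IsBddMeasurable fun ω => decay Γ (H n ω) :=
    isBddMeasurable_decay_comp hΓ (hC.measurable_H n)
  have hfresh := hC.setIntegral_jumpTime_succ hR (isLumped_none_link hlam) n
    (W := fun _ => 1) (.const 1) hκ t
  have hpumped := hC.setIntegral_decay_jumpTime_succ hR.exitRate_pos (isLumped_link_link hα hν) n
    (hV.isBddMeasurable n) hΓ hκ t
  have hshift := hC.setIntegral_jumpTime_succ hR (isLumped_link_link hα hν) n
    (W := fun _ => 1) (.const 1) hκ t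
  rw [hC.decayMean_succ (hbdd (n + 1)) hκ.le n {none}, mul_add, mul_left_comm _ a,
    mul_left_comm _ e, ← hpumped, ← hshift, ← hfresh, ← integral_const_mul,
    ← integral_const_mul, ← integral_const_mul, ← integral_add]
  · congr 1
    · refine setIntegral_congr_fun (hset _ _) fun ω hω => ?_
      simp only [entryExcess, if_pos (show Y n ω = none from hω.1)]
      ring
    · refine setIntegral_congr_fun (hset _ _) fun ω hω => ?_
      simp only [entryExcess, if_neg (show ¬ Y n ω = none from hω.1)]
      ring
  · exact (((((hbdd n).mul hheld).mul hlast).const_mul a).integrable P).integrableOn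
  · exact ((((IsBddMeasurable.const 1).mul hlast).const_mul e).integrable P).integrableOn

lemma Is1G1B.agedMean_entryExcess_eq_decayConv (hsys : Is1G1B lam mu q p P Y H) (hlam : 0 < lam)
    (hβ : 0 < mu + lam * q * (1 - p)) (hν : 0 ≤ lam * q * p)
    (hV : IsBddAdapted Y H (entryExcess Γ a e u Y H)) (hΓ : 0 ≤ Γ) :
    agedMean P Y H {none}ᶜ (entryExcess Γ a e u Y H) Γ =
      decayConv (mu + lam * q + Γ) fun s =>
        u * (lam * agedMean P Y H {none} (fun _ _ => 1) 0 s) +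
          lam * q * p * (a * agedMean P Y H {none}ᶜ (entryExcess Γ a e u Y H) Γ s +
            e * agedMean P Y H {none}ᶜ (fun _ _ => 1) 0 s) := by
  funext t
  have hC : IsCTMC _ _ P Y H := hsys
  have hR := isRegularRate_bufferRate hlam hβ hν
  have hκ : 0 < mu + lam * q + Γ := by linarith
  have hnone := isLumped_none_univ hlam hβ hν
  have hlink := isLumped_link_univ hlam hβ hν
  have hone := isBddAdapted_one Y H
  have hO := hC.isBddMeasurable_agedMean hR hnone hone le_rfl
  have hM := hC.isBddMeasurable_agedMean hR hlink hV hΓ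
  have hL := hC.isBddMeasurable_agedMean hR hlink hone le_rfl
  have hsumO := hC.hasSum_decayConv_decayMean hR hnone hone le_rfl hκ t
  have hsumL := hC.hasSum_decayConv_decayMean hR hlink hone le_rfl hκ t
  have hsumM := hC.hasSum_decayConv_decayMean hR hlink hV hΓ hκ t
  simp only [add_zero] at hsumO hsumL
  have hsucc := (hasSum_nat_add_iff' 1).2 (hC.hasSum_decayMean hR hlink hV hΓ t)
  rw [Finset.sum_range_one, hsys.decayMean_link_zero hR, sub_zero] at hsucc
  refine hsucc.unique ?_
  simp only [hsys.decayMean_entryExcess_succ hlam hβ hν hV hΓ]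
  rw [decayConv_add hκ ((hO.const_mul _).const_mul _)
    (((hM.const_mul _).add (hL.const_mul _)).const_mul _)]
  simp only [decayConv_const_mul]
  rw [decayConv_add hκ (hM.const_mul _) (hL.const_mul _)]
  simp only [decayConv_const_mul]
  exact ((hsumO.mul_left _).mul_left u).add
    (((hsumM.mul_left a).add (hsumL.mul_left e)).mul_left _)

end Recursion

section Equilibrium

section

variable {S Ω : Type*} [DecidableEq S] [Countable S] [MeasurableSpace Ω] {R : S → S → ℝ} {x₀ : S}
  {P : Measure Ω} [IsProbabilityMeasure P] {Y : ℕ → Ω → S} {H : ℕ → Ω → ℝ}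

lemma IsCTMC.ae_decay_zero_age (hC : IsCTMC R x₀ P Y H) (hR : IsRegularRate R) (t : ℝ) :
    ∀ᵐ ω ∂P, decay 0 (t - jumpTime H (jumpCount H t ω) ω) = decay 0 t := by
  filter_upwards [hC.ae_holdingTime_nonneg hR, hC.ae_exists_lt_jumpTime hR] with ω hH hω
  rcases lt_or_ge t 0 with ht | ht
  · simp only [jumpCount_of_neg hH ht, jumpTime, Finset.range_zero, Finset.sum_empty, sub_zero]
  · rw [decay_of_nonneg (sub_nonneg.2 (jumpTime_jumpCount_le hH (hω t) ht)), decay_of_nonneg ht,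
      zero_mul, zero_mul]

lemma IsCTMC.agedMean_one (hC : IsCTMC R x₀ P Y H) (hR : IsRegularRate R) (C : Set S) (t : ℝ) :
    agedMean P Y H C (fun _ _ => 1) 0 t = P.real {ω | stateAt Y H t ω ∈ C} * decay 0 t := by
  have hcongr : agedMean P Y H C (fun _ _ => 1) 0 t =
      ∫ _ in {ω | stateAt Y H t ω ∈ C}, decay 0 t ∂P :=
    integral_congr_ae (ae_restrict_of_ae ((hC.ae_decay_zero_age hR t).mono
      fun ω hω => (one_mul _).trans hω))
  rw [hcongr, setIntegral_const, smul_eq_mul]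

lemma IsCTMC.agedMean_one_add_compl (hC : IsCTMC R x₀ P Y H) (hR : IsRegularRate R) (C : Set S)
    (t : ℝ) :
    agedMean P Y H C (fun _ _ => 1) 0 t + agedMean P Y H Cᶜ (fun _ _ => 1) 0 t = decay 0 t := by
  rw [hC.agedMean_one hR, hC.agedMean_one hR, ← add_mul]
  have h := probReal_add_probReal_compl (μ := P) (hC.measurableSet_stateAt_mem t C)
  rw [show {ω | stateAt Y H t ω ∈ C}ᶜ = {ω | stateAt Y H t ω ∈ Cᶜ} from rfl] at h
  rw [h, one_mul]

end

variable {Ω : Type*} [MeasurableSpace Ω] {P : Measure Ω} [IsProbabilityMeasure P]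
  {Y : ℕ → Ω → Option ℕ} {H : ℕ → Ω → ℝ} {lam mu q p Γ a e u : ℝ}

lemma tendsto_decay_zero : Filter.Tendsto (decay 0) Filter.atTop (nhds 1) :=
  tendsto_const_nhds.congr' ((Filter.eventually_ge_atTop 0).mono fun t ht => by
    rw [decay_of_nonneg ht, zero_mul, neg_zero, Real.exp_zero])

lemma Is1G1B.tendsto_agedMean_link (hsys : Is1G1B lam mu q p P Y H) (hlam : 0 < lam)
    (hβ : 0 < mu + lam * q * (1 - p)) (hν : 0 ≤ lam * q * p) :
    Filter.Tendsto (agedMean P Y H {none}ᶜ (fun _ _ => 1) 0) Filter.atTop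
      (nhds (lam / (lam + (mu + lam * q * (1 - p))))) := by
  have hR := isRegularRate_bufferRate hlam hβ hν
  have hα : 0 < mu + lam * q := by linarith
  have hκ : 0 < lam + (mu + lam * q * (1 - p)) := by linarith
  have hone := isBddAdapted_one Y H
  have hbddO := IsCTMC.isBddMeasurable_agedMean hsys hR (isLumped_none_univ hlam hβ hν) hone le_rfl
  have hbddL := IsCTMC.isBddMeasurable_agedMean hsys hR (isLumped_link_univ hlam hβ hν) hone le_rfl
  have hL := hsys.agedMean_entryExcess_eq_decayConv (a := 0) (e := 1) (u := 1) hlam hβ hν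
    (entryExcess_zero_one_one 0 Y H ▸ hone) le_rfl
  simp only [entryExcess_zero_one_one, zero_mul, zero_add, one_mul, add_zero] at hL
  have hsource := (hbddO.const_mul lam).add (hbddL.const_mul (lam * q * p))
  refine tendsto_of_eq_decayConv hα hκ hsource hL ?_
  have hlim := tendsto_decay_zero.const_mul lam
  rw [mul_one] at hlim
  refine hlim.congr fun s => ?_
  rw [← IsCTMC.agedMean_one_add_compl hsys hR {none}]
  ring

lemma Is1G1B.tendsto_agedMean_entryExcess (hsys : Is1G1B lam mu q p P Y H) (hlam : 0 < lam)
    (hβ : 0 < mu + lam * q * (1 - p)) (hν : 0 ≤ lam * q * p)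
    (hV : IsBddAdapted Y H (entryExcess Γ a e u Y H)) (hΓ : 0 ≤ Γ)
    (hκ : 0 < mu + lam * q + Γ - lam * q * p * a) :
    Filter.Tendsto (agedMean P Y H {none}ᶜ (entryExcess Γ a e u Y H) Γ) Filter.atTop
      (nhds ((u * (mu + lam * q * (1 - p)) + lam * q * p * e) /
        (mu + lam * q + Γ - lam * q * p * a) * (lam / (lam + (mu + lam * q * (1 - p)))))) := by
  have hR := isRegularRate_bufferRate hlam hβ hν
  have hαΓ : 0 < mu + lam * q + Γ := by linarith
  have hone := isBddAdapted_one Y H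
  have hbddO := IsCTMC.isBddMeasurable_agedMean hsys hR (isLumped_none_univ hlam hβ hν) hone le_rfl
  have hbddL := IsCTMC.isBddMeasurable_agedMean hsys hR (isLumped_link_univ hlam hβ hν) hone le_rfl
  have hbddM := IsCTMC.isBddMeasurable_agedMean hsys hR (isLumped_link_univ hlam hβ hν) hV hΓ
  have hM := hsys.agedMean_entryExcess_eq_decayConv hlam hβ hν hV hΓ
  have hsource := ((hbddO.const_mul lam).const_mul u).add
    (((hbddM.const_mul a).add (hbddL.const_mul e)).const_mul (lam * q * p))
  have hlimL := hsys.tendsto_agedMean_link hlam hβ hν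
  have hlim := (((tendsto_decay_zero.sub hlimL).const_mul lam).const_mul u).add
    ((hlimL.const_mul e).const_mul (lam * q * p))
  convert tendsto_of_eq_decayConv hαΓ hκ hsource hM (hlim.congr fun s => ?_) using 2
  · field_simp
    ring
  · rw [← IsCTMC.agedMean_one_add_compl hsys hR {none}]
    ring

end Equilibrium

section Path

variable {lam mu q p Γ a b : ℝ}

lemma eq_none_of_bufferRate_some_zero_pos {x : Option ℕ}
    (h : 0 < bufferRate lam mu q p x (some 0)) : x = none := by
  rcases x with _ | i
  · rfl
  · simp [bufferRate] at h

lemma eq_some_of_bufferRate_some_succ_pos {x : Option ℕ} {j : ℕ}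
    (h : 0 < bufferRate lam mu q p x (some (j + 1))) : x = some j := by
  rcases x with _ | i
  · simp [bufferRate] at h
  · by_cases hij : j = i
    · rw [hij]
    · simp [bufferRate, hij] at h

lemma exists_climb_from_none {y : ℕ → Option ℕ} (h0 : y 0 = none)
    (hstep : ∀ n, 0 < bufferRate lam mu q p (y n) (y (n + 1))) {i n : ℕ} (hn : y n = some i) :
    ∃ M, n = M + 1 + i ∧ y M = none ∧ ∀ j ≤ i, y (M + 1 + j) = some j := by
  induction i generalizing n with
  | zero =>
    rcases n with _ | n
    · simp [h0] at hn
    · refine ⟨n, rfl, eq_none_of_bufferRate_some_zero_pos (hn ▸ hstep n), fun j hj => ?_⟩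
      rwa [Nat.le_zero.1 hj]
  | succ i ih =>
    rcases n with _ | n
    · simp [h0] at hn
    · obtain ⟨M, rfl, hM, hclimb⟩ := ih (eq_some_of_bufferRate_some_succ_pos (hn ▸ hstep n))
      refine ⟨M, rfl, hM, fun j hj => ?_⟩
      rcases hj.lt_or_eq with hlt | rfl
      exacts [hclimb j (Nat.le_of_lt_succ hlt), hn]

lemma depol_of_nonneg {t : ℝ} (ht : 0 ≤ t) (F : ℝ) :
    depol Γ t F = decay Γ t * (F - 1 / 4) + 1 / 4 := by
  rw [depol, decay_of_nonneg ht, neg_mul]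

variable {Ω : Type*} {Y : ℕ → Ω → Option ℕ} {H : ℕ → Ω → ℝ} {ω : Ω}
  {J : ℝ → TwoQubitState → ℝ} {ρ : TwoQubitState} {M i : ℕ}

lemma levelFidelity_eq_decay_mul_entryExcess (hJ : ∀ F, J F ρ = a * F + b) (hH : ∀ n, 0 ≤ H n ω)
    (hM : Y M ω = none) (hclimb : ∀ j ≤ i, Y (M + 1 + j) ω = some j) (τ : Fin (i + 1) → ℝ)
    (hτ : ∀ j : Fin (i + 1), (j : ℕ) < i → τ j = H (M + 1 + j) ω) (hlast : 0 ≤ τ (Fin.last i)) :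
    levelFidelity Γ J ρ i τ =
      decay Γ (τ (Fin.last i)) *
        entryExcess Γ a (a / 4 + b - 1 / 4) (ρ.fidelity - 1 / 4) Y H (M + 1 + i) ω + 1 / 4 := by
  induction i with
  | zero => simpa [levelFidelity, entryExcess, hM] using depol_of_nonneg hlast ρ.fidelity
  | succ i ih =>
    have hprev : τ (Fin.last i).castSucc = H (M + 1 + i) ω := hτ _ (Nat.lt_succ_self i)
    have h := ih (fun j hj => hclimb j (Nat.le_succ_of_le hj)) (fun j => τ j.castSucc)
      (fun j hj => hτ j.castSucc (Nat.lt_succ_of_lt hj)) (hprev ▸ hH _)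
    have hlink : Y (M + 1 + i) ω ≠ none := by simp [hclimb i (Nat.le_succ i)]
    rw [levelFidelity, h, hJ, depol_of_nonneg hlast, hprev, ← add_assoc (M + 1) i 1, entryExcess,
      if_neg hlink]
    ring

lemma levelTimes_of_lt {t : ℝ} (hN : jumpCount H t ω = M + 1 + i)
    (hclimb : ∀ j ≤ i, Y (M + 1 + j) ω = some j) (j : Fin (i + 1)) (hj : (j : ℕ) < i) :
    levelTimes Y H t ω i j = H (M + 1 + j) ω := by
  rw [levelTimes, if_neg hj.ne, hN]
  congr 1
  rw [Nat.findGreatest_eq_iff]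
  refine ⟨by lia, fun _ => hclimb j hj.le, fun m hm hm' h => ?_⟩
  have hlevel := hclimb (m - (M + 1)) (by lia)
  rw [Nat.add_sub_cancel' (by lia), h, Option.some_inj] at hlevel
  lia

lemma systemFidelity_of_stateAt_eq_none {t : ℝ} (h : stateAt Y H t ω = none) :
    systemFidelity Γ J ρ Y H t ω = 0 := by
  rw [systemFidelity, h]

lemma systemFidelity_eq_decay_mul_entryExcess (hJ : ∀ F, J F ρ = a * F + b)
    (hH : ∀ n, 0 ≤ H n ω) (h0 : Y 0 ω = none)
    (hstep : ∀ n, 0 < bufferRate lam mu q p (Y n ω) (Y (n + 1) ω)) {t : ℝ}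
    (hage : jumpTime H (jumpCount H t ω) ω ≤ t) (hlink : stateAt Y H t ω ≠ none) :
    systemFidelity Γ J ρ Y H t ω =
      entryExcess Γ a (a / 4 + b - 1 / 4) (ρ.fidelity - 1 / 4) Y H (jumpCount H t ω) ω *
        decay Γ (t - jumpTime H (jumpCount H t ω) ω) + 1 / 4 := by
  obtain ⟨i, hi⟩ := Option.ne_none_iff_exists'.1 hlink
  obtain ⟨M, hN, hM, hclimb⟩ := exists_climb_from_none h0 hstep hi
  have hlast : levelTimes Y H t ω i (Fin.last i) = t - jumpTime H (jumpCount H t ω) ω :=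
    if_pos (Fin.val_last i)
  have hsys : systemFidelity Γ J ρ Y H t ω = levelFidelity Γ J ρ i (levelTimes Y H t ω i) := by
    rw [systemFidelity, hi]
  rw [hsys, levelFidelity_eq_decay_mul_entryExcess hJ hH hM hclimb _ (levelTimes_of_lt hN hclimb)
    (hlast ▸ sub_nonneg.2 hage), hlast, hN, mul_comm]

end Path

section JumpFunction

variable {a b : ℝ}

lemma abs_slope_le_one (hJ : Set.MapsTo (fun F => a * F + b) (Set.Icc 0 1) (Set.Icc 0 1)) :
    |a| ≤ 1 := by
  have h0 := hJ (Set.left_mem_Icc.2 zero_le_one)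
  have h1 := hJ (Set.right_mem_Icc.2 zero_le_one)
  simp only [mul_zero, zero_add, mul_one, Set.mem_Icc] at h0 h1
  exact abs_le.2 ⟨by linarith, by linarith⟩

lemma mapsTo_closedBall_of_mapsTo_Icc
    (hJ : Set.MapsTo (fun F => a * F + b) (Set.Icc 0 1) (Set.Icc 0 1)) {r : ℝ} (hr : 1 / 2 ≤ r) :
    Set.MapsTo (fun x => a * x + (a / 4 + b - 1 / 4))
      (Metric.closedBall (1 / 4) r) (Metric.closedBall (1 / 4) r) := by
  have h0 := hJ (Set.left_mem_Icc.2 zero_le_one)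
  have h1 := hJ (Set.right_mem_Icc.2 zero_le_one)
  simp only [mul_zero, zero_add, mul_one, Set.mem_Icc] at h0 h1
  intro x hx
  rw [Metric.mem_closedBall, Real.dist_eq, abs_le] at hx ⊢
  rcases le_total 0 a with ha | ha <;> constructor <;> nlinarith

lemma isBddAdapted_entryExcess_of_mapsTo_Icc {Ω : Type*} {Γ : ℝ}
    (hJ : Set.MapsTo (fun F => a * F + b) (Set.Icc 0 1) (Set.Icc 0 1)) (hΓ : 0 ≤ Γ) (u : ℝ)
    (Y : ℕ → Ω → Option ℕ) (H : ℕ → Ω → ℝ) :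
    IsBddAdapted Y H (entryExcess Γ a (a / 4 + b - 1 / 4) u Y H) := by
  have hr : 1 / 2 ≤ max (1 / 2) |u - 1 / 4| := le_max_left _ _
  refine isBddAdapted_entryExcess (convex_closedBall (1 / 4) _) Metric.isBounded_closedBall ?_
    (Metric.mem_closedBall.2 (le_max_right _ _)) (mapsTo_closedBall_of_mapsTo_Icc hJ hr) hΓ
  rw [Metric.mem_closedBall, Real.dist_eq]
  norm_num

end JumpFunction

section ConsumedFidelity

variable {Ω : Type*} [MeasurableSpace Ω] {P : Measure Ω} [IsProbabilityMeasure P]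
  {Y : ℕ → Ω → Option ℕ} {H : ℕ → Ω → ℝ} {lam mu q p Γ a b : ℝ} {J : ℝ → TwoQubitState → ℝ}
  {ρ : TwoQubitState}

lemma Is1G1B.ae_systemFidelity_eq (hsys : Is1G1B lam mu q p P Y H)
    (hR : IsRegularRate (bufferRate lam mu q p)) (hJ : ∀ F, J F ρ = a * F + b) (t : ℝ) :
    systemFidelity Γ J ρ Y H t =ᵐ[P] {ω | stateAt Y H t ω ≠ none}.indicator
      fun ω => entryExcess Γ a (a / 4 + b - 1 / 4) (ρ.fidelity - 1 / 4) Y H (jumpCount H t ω) ω *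
        decay Γ (t - jumpTime H (jumpCount H t ω) ω) + 1 / 4 := by
  filter_upwards [IsCTMC.ae_start hsys hR.exitRate_pos, IsCTMC.ae_holdingTime_nonneg hsys hR,
    IsCTMC.ae_rate_pos hsys hR, IsCTMC.ae_exists_lt_jumpTime hsys hR] with ω h0 hH hstep hω
  by_cases hs : stateAt Y H t ω = none
  · rw [Set.indicator_of_notMem (not_not_intro hs), systemFidelity_of_stateAt_eq_none hs]
  · have ht : 0 ≤ t := le_of_not_gt fun ht => hs (by rw [stateAt, jumpCount_of_neg hH ht, h0])
    rw [Set.indicator_of_mem hs,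
      systemFidelity_eq_decay_mul_entryExcess hJ hH h0 hstep
        (jumpTime_jumpCount_le hH (hω t) ht) hs]

lemma Is1G1B.integrable_systemFidelity (hsys : Is1G1B lam mu q p P Y H)
    (hR : IsRegularRate (bufferRate lam mu q p)) (hJ : ∀ F, J F ρ = a * F + b)
    (hV : IsBddAdapted Y H (entryExcess Γ a (a / 4 + b - 1 / 4) (ρ.fidelity - 1 / 4) Y H))
    (hΓ : 0 ≤ Γ) (t : ℝ) : Integrable (systemFidelity Γ J ρ Y H t) P :=
  ((((IsCTMC.isBddMeasurable_aged hsys hV hΓ t).add (.const (1 / 4))).integrable P).indicator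
    (IsCTMC.measurableSet_stateAt_mem hsys t {none}ᶜ)).congr
      (hsys.ae_systemFidelity_eq hR hJ t).symm

lemma Is1G1B.condMeanFidelity_eq (hsys : Is1G1B lam mu q p P Y H)
    (hR : IsRegularRate (bufferRate lam mu q p)) (hJ : ∀ F, J F ρ = a * F + b)
    (hV : IsBddAdapted Y H (entryExcess Γ a (a / 4 + b - 1 / 4) (ρ.fidelity - 1 / 4) Y H))
    (hΓ : 0 ≤ Γ) {t : ℝ} (ht : 0 ≤ t) :
    condMeanFidelity Γ J ρ P Y H t =
      (agedMean P Y H {none}ᶜ (fun _ _ => 1) 0 t)⁻¹ *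
        (agedMean P Y H {none}ᶜ
            (entryExcess Γ a (a / 4 + b - 1 / 4) (ρ.fidelity - 1 / 4) Y H) Γ t +
          agedMean P Y H {none}ᶜ (fun _ _ => 1) 0 t * (1 / 4)) := by
  have hmeas : MeasurableSet {ω | stateAt Y H t ω ≠ none} :=
    IsCTMC.measurableSet_stateAt_mem hsys t {none}ᶜ
  have hprob : agedMean P Y H {none}ᶜ (fun _ _ => 1) 0 t = P.real {ω | stateAt Y H t ω ≠ none} := by
    rw [IsCTMC.agedMean_one hsys hR, decay_of_nonneg ht, zero_mul, neg_zero, Real.exp_zero, mul_one]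
    rfl
  have hint : ∫ ω in {ω | stateAt Y H t ω ≠ none}, systemFidelity Γ J ρ Y H t ω ∂P =
      agedMean P Y H {none}ᶜ (entryExcess Γ a (a / 4 + b - 1 / 4) (ρ.fidelity - 1 / 4) Y H) Γ t +
        P.real {ω | stateAt Y H t ω ≠ none} * (1 / 4) := by
    rw [setIntegral_congr_ae hmeas ((hsys.ae_systemFidelity_eq hR hJ t).mono fun ω hω hmem =>
        hω.trans (Set.indicator_of_mem hmem _)),
      integral_add ((IsCTMC.isBddMeasurable_aged hsys hV hΓ t).integrable P).integrableOn
        (integrable_const _), setIntegral_const, smul_eq_mul]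
    rfl
  rw [hprob, ← hint, condMeanFidelity, ProbabilityTheory.cond, integral_smul_measure,
    ENNReal.toReal_inv, smul_eq_mul]
  rfl

lemma Is1G1B.isAvgConsumedFidelity (hsys : Is1G1B lam mu q p P Y H) (hlam : 0 < lam)
    (hβ : 0 < mu + lam * q * (1 - p)) (hν : 0 ≤ lam * q * p) (hΓ : 0 ≤ Γ)
    (hJ : ∀ F, J F ρ = a * F + b)
    (hJrange : Set.MapsTo (fun F => a * F + b) (Set.Icc 0 1) (Set.Icc 0 1)) :
    IsAvgConsumedFidelity Γ J ρ P Y H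
      ((1 / 4 * Γ + b * lam * q * p + ρ.fidelity * (mu + lam * q * (1 - p))) /
        (Γ + mu + lam * q * (1 - p * a))) := by
  have hR := isRegularRate_bufferRate hlam hβ hν
  have hV := isBddAdapted_entryExcess_of_mapsTo_Icc hJrange hΓ (ρ.fidelity - 1 / 4) Y H
  have hκ : 0 < mu + lam * q + Γ - lam * q * p * a := by
    nlinarith [(abs_le.1 (abs_slope_le_one hJrange)).2]
  have hlink : 0 < lam + (mu + lam * q * (1 - p)) := add_pos hlam hβ
  have hL := hsys.tendsto_agedMean_link hlam hβ hν
  have hM := hsys.tendsto_agedMean_entryExcess hlam hβ hν hV hΓ hκ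
  refine ⟨hsys.integrable_systemFidelity hR hJ hV hΓ, ?_⟩
  have hlim := ((hL.inv₀ (div_pos hlam hlink).ne').mul (hM.add (hL.mul_const (1 / 4)))).congr'
    ((Filter.eventually_ge_atTop 0).mono fun t ht =>
      (hsys.condMeanFidelity_eq hR hJ hV hΓ ht).symm)
  convert hlim using 2
  have hκ' : Γ + mu + lam * q * (1 - p * a) = mu + lam * q + Γ - lam * q * p * a := by ring
  rw [mul_comm (_ / (_ - _)), ← mul_add, inv_mul_cancel_left₀ (div_pos hlam hlink).ne', hκ',
    ← sub_eq_iff_eq_add]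
  field_simp
  ring

end ConsumedFidelity

section LevelAverage

variable {r Γ a b : ℝ} {J : ℝ → TwoQubitState → ℝ} {ρ : TwoQubitState}

lemma ae_decay_eq_exp (r Γ : ℝ) : decay Γ =ᵐ[expMeasure r] fun h => Real.exp (-Γ * h) := by
  have hnonneg : ∀ᵐ h ∂(expMeasure r), 0 ≤ h := by
    simp only [ae_iff, not_le]
    exact expMeasure_Iio_zero r
  filter_upwards [hnonneg] with h hh
  rw [decay_of_nonneg hh, neg_mul]

lemma integrable_exp_expMeasure (hr : 0 < r) (hΓ : 0 ≤ Γ) :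
    Integrable (fun h => Real.exp (-Γ * h)) (expMeasure r) := by
  have := isProbabilityMeasure_expMeasure hr
  exact ((isBddMeasurable_decay hΓ).integrable _).congr (ae_decay_eq_exp r Γ)

lemma integral_exp_expMeasure (hr : 0 < r) (hΓ : 0 ≤ Γ) :
    ∫ h, Real.exp (-Γ * h) ∂(expMeasure r) = r / (r + Γ) :=
  (integral_congr_ae (ae_decay_eq_exp r Γ)).symm.trans (integral_decay_expMeasure hr hΓ)

lemma integral_depol_prod {E : Type*} [MeasurableSpace E] {ν : Measure E} [IsProbabilityMeasure ν]
    (hr : 0 < r) (hΓ : 0 ≤ Γ) {f : E → ℝ} (hf : Integrable f ν) :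
    Integrable (fun z : ℝ × E => depol Γ z.1 (f z.2)) ((expMeasure r).prod ν) ∧
      ∫ z, depol Γ z.1 (f z.2) ∂((expMeasure r).prod ν) =
        r / (r + Γ) * ((∫ x, f x ∂ν) - 1 / 4) + 1 / 4 := by
  have := isProbabilityMeasure_expMeasure hr
  have hexcess : Integrable (fun x => f x - 1 / 4) ν := hf.sub (integrable_const _)
  have hprod := (integrable_exp_expMeasure hr hΓ).mul_prod hexcess
  refine ⟨hprod.add (integrable_const _), ?_⟩
  simp only [depol]
  rw [integral_add hprod (integrable_const _),
    integral_prod_mul (fun h => Real.exp (-Γ * h)) (fun x => f x - 1 / 4),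
    integral_exp_expMeasure hr hΓ, integral_sub hf (integrable_const _), integral_const,
    integral_const, probReal_univ, probReal_univ, one_smul]

lemma integral_depol_last (hr : 0 < r) (hΓ : 0 ≤ Γ) {n : ℕ} {f : (Fin n → ℝ) → ℝ}
    (hf : Integrable f (Measure.pi fun _ => expMeasure r)) :
    Integrable (fun t : Fin (n + 1) → ℝ => depol Γ (t (Fin.last n)) (f fun j => t j.castSucc))
        (Measure.pi fun _ => expMeasure r) ∧
      ∫ t : Fin (n + 1) → ℝ, depol Γ (t (Fin.last n)) (f fun j => t j.castSucc)
          ∂(Measure.pi fun _ => expMeasure r) =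
        r / (r + Γ) * ((∫ t, f t ∂(Measure.pi fun _ => expMeasure r)) - 1 / 4) + 1 / 4 := by
  have := isProbabilityMeasure_expMeasure hr
  have hsplit := measurePreserving_piFinSuccAbove (fun _ : Fin (n + 1) => expMeasure r) (Fin.last n)
  have hcomp : (fun t : Fin (n + 1) → ℝ => depol Γ (t (Fin.last n)) (f fun j => t j.castSucc)) =
      (fun z : ℝ × (Fin n → ℝ) => depol Γ z.1 (f z.2)) ∘
        MeasurableEquiv.piFinSuccAbove (fun _ => ℝ) (Fin.last n) := by
    funext t
    simp only [Function.comp_apply, MeasurableEquiv.piFinSuccAbove_apply,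
      Fin.insertNthEquiv_symm_apply, Fin.removeNth_last]
    rfl
  obtain ⟨hint, hval⟩ := integral_depol_prod hr hΓ hf
  rw [hcomp]
  exact ⟨hsplit.integrable_comp_of_integrable hint, (hsplit.integral_comp' _).trans hval⟩

lemma integral_levelFidelity (hr : 0 < r) (hΓ : 0 ≤ Γ) (hJ : ∀ F, J F ρ = a * F + b) (i : ℕ) :
    Integrable (levelFidelity Γ J ρ i) (iidExp r i) ∧
      ∫ t, levelFidelity Γ J ρ i t ∂(iidExp r i) =
        arithGeom (a * (r / (r + Γ))) ((a / 4 + b - 1 / 4) * (r / (r + Γ)))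
          ((ρ.fidelity - 1 / 4) * (r / (r + Γ))) i + 1 / 4 := by
  have := isProbabilityMeasure_expMeasure hr
  induction i with
  | zero =>
    obtain ⟨hint, hval⟩ := integral_depol_last hr hΓ (n := 0) (integrable_const ρ.fidelity)
    refine ⟨hint, hval.trans ?_⟩
    rw [integral_const, probReal_univ, one_smul, arithGeom_zero, mul_comm]
  | succ i ih =>
    have : IsProbabilityMeasure (iidExp r i) := by unfold iidExp; infer_instance
    have hpumped : Integrable (fun t => J (levelFidelity Γ J ρ i t) ρ) (iidExp r i) := by
      simp only [hJ]
      exact (ih.1.const_mul a).add (integrable_const b)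
    obtain ⟨hint, hval⟩ := integral_depol_last hr hΓ hpumped
    refine ⟨hint, hval.trans ?_⟩
    simp only [hJ]
    rw [← iidExp, integral_add (ih.1.const_mul a) (integrable_const b), integral_const_mul, ih.2,
      integral_const, probReal_univ, one_smul, arithGeom_succ]
    ring

lemma excess_intercept_eq_zero_of_mul_eq_one
    (hJ : Set.MapsTo (fun F => a * F + b) (Set.Icc 0 1) (Set.Icc 0 1)) {γ : ℝ}
    (hγ : γ ∈ Set.Icc 0 1) (h : a * γ = 1) : a / 4 + b - 1 / 4 = 0 := by
  have h0 := hJ (Set.left_mem_Icc.2 zero_le_one)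
  have h1 := hJ (Set.right_mem_Icc.2 zero_le_one)
  simp only [mul_zero, zero_add, mul_one, Set.mem_Icc] at h0 h1
  have ha : a = 1 := by nlinarith [hγ.1, hγ.2]
  linarith

lemma avgLevelFidelity_eq {lam mu q γ : ℝ} (hα : 0 < mu + lam * q) (hΓ : 0 ≤ Γ)
    (hγ : γ = (mu + lam * q) / (mu + lam * q + Γ)) (hJ : ∀ F, J F ρ = a * F + b)
    (hJrange : Set.MapsTo (fun F => a * F + b) (Set.Icc 0 1) (Set.Icc 0 1)) (i : ℕ) :
    avgLevelFidelity lam mu q Γ J ρ i =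
      1 / 4 + (ρ.fidelity - 1 / 4) * a ^ i * γ ^ (i + 1) +
        (a / 4 + b - 1 / 4) * γ * ((1 - a ^ i * γ ^ i) / (1 - a * γ)) := by
  rw [avgLevelFidelity, (integral_levelFidelity hα hΓ hJ i).2, ← hγ, arithGeom_eq_add_sum]
  by_cases hone : a * γ = 1
  · have hγ01 : γ ∈ Set.Icc 0 1 :=
      hγ ▸ ⟨by positivity, div_le_one_of_le₀ (le_add_of_nonneg_right hΓ) (by positivity)⟩
    rw [excess_intercept_eq_zero_of_mul_eq_one hJrange hγ01 hone]
    ring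
  · rw [geom_sum_eq hone, ← neg_sub 1, ← neg_sub 1 (a * γ), neg_div_neg_eq]
    ring

end LevelAverage

end Buffer

end

theorem lemma1_general {Ω : Type*} [MeasurableSpace Ω] (P : Measure Ω) [IsProbabilityMeasure P]
    (lam mu q p Γ : ℝ) (hlam : 0 < lam) (hβ : 0 < mu + lam * q * (1 - p))
    (hν : 0 ≤ lam * q * p) (hΓ : 0 ≤ Γ)
    (Y : ℕ → Ω → Option ℕ) (H : ℕ → Ω → ℝ) (hsys : Buffer.Is1G1B lam mu q p P Y H)
    (ρ : Buffer.TwoQubitState) (J : ℝ → Buffer.TwoQubitState → ℝ) (a b : ℝ)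
    (hJ : ∀ F, J F ρ = a * F + b)
    (hJrange : ∀ F ∈ Set.Icc (0 : ℝ) 1, J F ρ ∈ Set.Icc (0 : ℝ) 1)
    (α γ : ℝ) (hα : α = mu + lam * q) (hγ : γ = α / (α + Γ)) :
    (∀ i : ℕ,
      Integrable (Buffer.levelFidelity Γ J ρ i) (Buffer.iidExp (mu + lam * q) i) ∧
      Buffer.avgLevelFidelity lam mu q Γ J ρ i =
        1 / 4 + (ρ.fidelity - 1 / 4) * a ^ i * γ ^ (i + 1) +
          (a / 4 + b - 1 / 4) * γ * ((1 - a ^ i * γ ^ i) / (1 - a * γ))) ∧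
    Buffer.IsAvgConsumedFidelity Γ J ρ P Y H
      ((1 / 4 * Γ + b * lam * q * p + ρ.fidelity * (mu + lam * q * (1 - p))) /
        (Γ + mu + lam * q * (1 - p * a))) := by
  have hα0 : 0 < mu + lam * q := by linarith
  have hmaps : Set.MapsTo (fun F => a * F + b) (Set.Icc 0 1) (Set.Icc 0 1) :=
    fun F hF => Set.mem_of_eq_of_mem (hJ F).symm (hJrange F hF)
  subst hα
  exact ⟨fun i => ⟨(Buffer.integral_levelFidelity hα0 hΓ hJ i).1,
      Buffer.avgLevelFidelity_eq hα0 hΓ hγ hJ hmaps i⟩,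
    hsys.isAvgConsumedFidelity hlam hβ hν hΓ hJ hmaps⟩

theorem lemma1 {Ω : Type*} [MeasurableSpace Ω] (P : Measure Ω) [IsProbabilityMeasure P]
    (lam mu q p Γ : ℝ) (hlam : 0 < lam) (hmu : 0 < mu) (hq : q ∈ Set.Icc (0 : ℝ) 1)
    (hp : p ∈ Set.Icc (0 : ℝ) 1) (hΓ : 0 ≤ Γ)
    (Y : ℕ → Ω → Option ℕ) (H : ℕ → Ω → ℝ) (hsys : Buffer.Is1G1B lam mu q p P Y H)
    (ρ : Buffer.TwoQubitState) (J : ℝ → Buffer.TwoQubitState → ℝ) (a b : ℝ)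
    (hJ : ∀ F, J F ρ = a * F + b)
    (hJrange : ∀ F ∈ Set.Icc (0 : ℝ) 1, J F ρ ∈ Set.Icc (0 : ℝ) 1)
    (α γ : ℝ) (hα : α = mu + lam * q) (hγ : γ = α / (α + Γ)) :
    (∀ i : ℕ,
      Integrable (Buffer.levelFidelity Γ J ρ i) (Buffer.iidExp (mu + lam * q) i) ∧
      Buffer.avgLevelFidelity lam mu q Γ J ρ i =
        1 / 4 + (ρ.fidelity - 1 / 4) * a ^ i * γ ^ (i + 1) +
          (a / 4 + b - 1 / 4) * γ * ((1 - a ^ i * γ ^ i) / (1 - a * γ))) ∧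
    Buffer.IsAvgConsumedFidelity Γ J ρ P Y H
      ((1 / 4 * Γ + b * lam * q * p + ρ.fidelity * (mu + lam * q * (1 - p))) /
        (Γ + mu + lam * q * (1 - p * a))) := by
  have hlq : 0 ≤ lam * q := mul_nonneg hlam.le hq.1
  exact lemma1_general P lam mu q p Γ hlam
    (add_pos_of_pos_of_nonneg hmu (mul_nonneg hlq (sub_nonneg.2 hp.2))) (mul_nonneg hlq hp.1) hΓ
    Y H hsys ρ J a b hJ hJrange α γ hα hγ
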